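/- Let $n\ge 0$ be an integer and $q>0$ a real number. A half-diagram on $n$ points is a partition of $\{1,\dots,n\}$ into sets of one element (points with a through-string) or two elements (arches) which is noncrossing: there are no arches $\{i,j\}$, $\{k,l\}$ with $i<k<j<l$, and no arch $\{i,j\}$ and through-string point $k$ with $i<k<j$. Let $U(n)$ be the complex vector space with basis $\{\xi_{\mathfrak a}\}$ indexed by the half-diagrams on $n$ points, with the sesquilinear form determined as follows. Identify the points of $\mathfrak a$ with those of $\mathfrak b$. If some path connects two different through-strings of the same half-diagram, then $\langle\xi_{\mathfrak a},\xi_{\mathfrak b}\rangle=0$; otherwise $\langle\xi_{\mathfrak a},\xi_{\mathfrak b}\rangle=q^{c}$, where $c$ is the number of closed loops. The Temperley-Lieb algebra $TL_n(q)$ acts on $U(n)$ by concatenation of diagrams: each closed loop contributes a factor $q$, and the result is $0$ if two through-strings of the half-diagram become connected. Let $e_1,\dots,e_{n-1}$ be the standard diagrammatic generators. The $k$-th bracket of $\mathfrak a$ is opening if $k$ has a through-string or is joined to a larger point, and closing otherwise. Let $h_i(\mathfrak a)$ be the number of opening minus the number of closing brackets among the first $i$ brackets. A half-diagram is uniquely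 determined by its sequence of brackets. It has a minimum at $i$ ($1\le i<n$) if its $i$-th bracket is closing and its $(i+1)$-th is opening; then $\Diamond_i(\mathfrak a)$ is the half-diagram obtained by making the $i$-th bracket opening and the $(i+1)$-th closing. The minimal half-diagram with $p$ arches is the one with arches $\{1,2\},\{3,4\},\dots,\{2p-1,2p\}$; equivalently, the height just before every closing bracket is $1$. Let $\Delta_k=\Delta_k(q)$ be the Chebyshev polynomials with $\Delta_{-1}=0$, $\Delta_0=1$, $\Delta_{k+1}=q\Delta_k-\Delta_{k-1}$, and let $\mu_k=\Delta_{k-1}/\Delta_k$. Define vectors $\xi'_{\mathfrak a}$ by $\xi'_{\mathfrak a}=\xi_{\mathfrak a}$ if $\mathfrak a$ is minimal, and $$\xi'_{\Diamond_i(\mathfrak a)}=\bigl(e_i-\mu_{h_i(\mathfrak a)+1}\bigr)\,\xi'_{\mathfrak a}\qquad\text{if }\mathfrak a\text{ has a minimum at }i .$$ Call $p$ admissible if $\Delta_{h_i(\mathfrak c)+1}(q)\ne 0$ for every half-diagram $\mathfrak c$ on $n$ points with $p$ arches and every minimum $i$ of $\mathfrak c$, i.e. if all the quotients $\mu$ occurring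 in this definition for half-diagrams with $p$ arches are well-defined. **Theorem.** (1) If the number of arches of $\mathfrak a$ is admissible, then $\xi'_{\mathfrak a}$ is well-defined: $\mathfrak a$ can be reached from a minimal half-diagram by box additions $\Diamond_i$, and the resulting vector does not depend on the sequence of box additions. (2) If $\mathfrak a\ne\mathfrak b$ are half-diagrams on $n$ points whose numbers of arches are both admissible, then $\langle\xi'_{\mathfrak a},\xi'_{\mathfrak b}\rangle=0$, whether or not $\mathfrak a$ and $\mathfrak b$ have the same number of through-strings. -/

import Mathlib

/-- A (noncrossing) half-diagram on `n` points: a partition of the points into sets of one or two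
elements, given by the involution `partner`. A fixed point of `partner` carries a through-string;
two points exchanged by `partner` are joined by an arch. Point `k : Fin n` is the `(k+1)`-th point. -/
@[ext]
structure HalfDiagram (n : ℕ) where
  partner : Fin n → Fin n
  partner_partner : ∀ i, partner (partner i) = i
  /-- two arches do not cross -/
  arch_arch : ∀ i k, ¬ (i < k ∧ k < partner i ∧ partner i < partner k)
  /-- no through-string lies below an arch -/
  arch_through : ∀ i k, ¬ (i < k ∧ k < partner i ∧ partner k = k)

/-- The numbering of the `2n` points of a diagram in `TL_n` by `1, …, 2n`: `Sum.inl k` is the point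
number `k + 1`, on the left side, and `Sum.inr k` is the point opposite to it on the right side,
which has the number `2n - k`. -/
def tlNumber (n : ℕ) : Fin n ⊕ Fin n → ℕ
  | Sum.inl k => k.val + 1
  | Sum.inr k => 2 * n - k.val

/-- A (noncrossing) pairing of `2n` points, a basis diagram of the Temperley-Lieb algebra `TL_n`. -/
@[ext]
structure TLDiagram (n : ℕ) where
  partner : Fin n ⊕ Fin n → Fin n ⊕ Fin n
  partner_partner : ∀ x, partner (partner x) = x
  partner_ne : ∀ x, partner x ≠ x
  noncrossing : ∀ x y, ¬ (tlNumber n x < tlNumber n y ∧ tlNumber n y < tlNumber n (partner x) ∧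
    tlNumber n (partner x) < tlNumber n (partner y))

/-- The diagram of the generator `e_{i+1}`, which joins the points `i + 1` and `i + 2` on the
left to each other, likewise the points opposite to them on the right, and joins every other point to the point
opposite to it. -/
def tlGen {n : ℕ} (i : ℕ) (hi : i + 1 < n) : TLDiagram n where
  partner
    | Sum.inl k => if k.val = i then Sum.inl ⟨i + 1, hi⟩
        else if k.val = i + 1 then Sum.inl ⟨i, by omega⟩ else Sum.inr k
    | Sum.inr k => if k.val = i then Sum.inr ⟨i + 1, hi⟩
        else if k.val = i + 1 then Sum.inr ⟨i, by omega⟩ else Sum.inl k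
  partner_partner := by
    rintro (⟨k, hk⟩ | ⟨k, hk⟩) <;> dsimp only <;> split_ifs <;> simp_all
  partner_ne := by
    rintro (⟨k, hk⟩ | ⟨k, hk⟩) <;> dsimp only <;> split_ifs <;> simp_all
  noncrossing := by
    rintro (⟨k, hk⟩ | ⟨k, hk⟩) (⟨l, hl⟩ | ⟨l, hl⟩) <;> dsimp only <;> split_ifs <;>
      simp only [tlNumber] <;> omega

/-- The space `U(n)` of formal complex linear combinations of half-diagrams on `n` points. The basis
element belonging to the half-diagram `a` is `Finsupp.single a 1`. -/
abbrev HalfSpace (n : ℕ) : Type := HalfDiagram n →₀ ℂ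

/-! ### Concatenations -/

/-- The concatenation of a diagram `p` with a half-diagram `a`: the graph on the `2n` points of `p`
in which, besides the edges of `p`, the right points `Sum.inr k` are identified with the points `k`
of `a` and joined by the arches of `a`. -/
def concatGraph {n : ℕ} (p : TLDiagram n) (a : HalfDiagram n) : SimpleGraph (Fin n ⊕ Fin n) :=
  SimpleGraph.fromRel fun x y => p.partner x = y ∨
    ∃ k : Fin n, x = Sum.inr k ∧ y = Sum.inr (a.partner k)

/-- Some path in the concatenation connects two different through-strings of `a`. -/
def ConcatVanishes {n : ℕ} (p : TLDiagram n) (a : HalfDiagram n) : Prop :=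
  ∃ i j : Fin n, i ≠ j ∧ a.partner i = i ∧ a.partner j = j ∧
    (concatGraph p a).Reachable (Sum.inr i) (Sum.inr j)

/-- The number of closed loops of the concatenation. Every vertex has two edges, apart from the left
points (one edge in the graph) and the points at which `a` has a through-string (where the second
edge goes to infinity), so the closed loops are the components that contain neither. -/
noncomputable def concatLoops {n : ℕ} (p : TLDiagram n) (a : HalfDiagram n) : ℕ :=
  Nat.card {C : (concatGraph p a).ConnectedComponent //
    ∀ k : Fin n, Sum.inl k ∉ C.supp ∧ (a.partner k = k → Sum.inr k ∉ C.supp)}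

/-- `b` is the half-diagram left on the left points of the concatenation after the identified points
and the closed loops have been deleted: two different points are joined by an arch of `b` exactly if
a path of the concatenation connects them. -/
def IsConcat {n : ℕ} (p : TLDiagram n) (a b : HalfDiagram n) : Prop :=
  ∀ i j : Fin n, i ≠ j →
    (b.partner i = j ↔ (concatGraph p a).Reachable (Sum.inl i) (Sum.inl j))

/-- There is at most one half-diagram left by a concatenation. -/
theorem IsConcat.unique {n : ℕ} {p : TLDiagram n} {a b c : HalfDiagram n}
    (hb : IsConcat p a b) (hc : IsConcat p a c) : b = c := by
  ext i
  congr 1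
  by_cases h : b.partner i = i
  · by_cases h' : c.partner i = i
    · rw [h, h']
    · have := (hb i (c.partner i) (Ne.symm h')).2 ((hc i (c.partner i) (Ne.symm h')).1 rfl)
      exact this
  · exact ((hc i (b.partner i) (Ne.symm h)).2 ((hb i (b.partner i) (Ne.symm h)).1 rfl)).symm

open Classical in
/-- The action of the basis element of `TL_n(q)` belonging to the diagram `p` on the basis element
belonging to `a`: it is `0` if two through-strings of `a` become connected, and otherwise `q ^ c`
times the basis element of the half-diagram `b` left by the concatenation, where `c` is the number
of closed loops. -/
noncomputable def tlActBasis {n : ℕ} (q : ℝ) (p : TLDiagram n) (a : HalfDiagram n) : HalfSpace n :=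
  if h : ¬ ConcatVanishes p a ∧ ∃ b, IsConcat p a b then
    Finsupp.single h.2.choose ((q : ℂ) ^ concatLoops p a)
  else 0

/-- The linear extension of this action to `U(n)`. -/
noncomputable def tlAct {n : ℕ} (q : ℝ) (p : TLDiagram n) : HalfSpace n →ₗ[ℂ] HalfSpace n :=
  Finsupp.linearCombination ℂ (tlActBasis q p)

/-! ### The sesquilinear form -/

/-- The graph obtained from two half-diagrams by identifying their points. -/
def glueGraph {n : ℕ} (a b : HalfDiagram n) : SimpleGraph (Fin n) :=
  SimpleGraph.fromRel fun i j => a.partner i = j ∨ b.partner i = j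

/-- Some path connects two different through-strings of the same half-diagram. -/
def GlueVanishes {n : ℕ} (a b : HalfDiagram n) : Prop :=
  ∃ i j : Fin n, i ≠ j ∧ (glueGraph a b).Reachable i j ∧
    ((a.partner i = i ∧ a.partner j = j) ∨ (b.partner i = i ∧ b.partner j = j))

/-- The number of closed loops: the components without a through-string of `a` or `b`. -/
noncomputable def glueLoops {n : ℕ} (a b : HalfDiagram n) : ℕ :=
  Nat.card {C : (glueGraph a b).ConnectedComponent //
    ∀ k ∈ C.supp, a.partner k ≠ k ∧ b.partner k ≠ k}

open Classical in
/-- The value of the form on two basis elements. -/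
noncomputable def halfFormBasis {n : ℕ} (q : ℝ) (a b : HalfDiagram n) : ℝ :=
  if GlueVanishes a b then 0 else q ^ glueLoops a b

/-- The diagrammatic sesquilinear form on `U(n)`, linear in the first and conjugate linear in the
second argument. -/
noncomputable def halfForm {n : ℕ} (q : ℝ) (u v : HalfSpace n) : ℂ :=
  u.sum fun a x => v.sum fun b y => x * (starRingEnd ℂ) y * (halfFormBasis q a b : ℂ)

/-! ### Dyck paths and box addition -/

namespace HalfDiagram

variable {n : ℕ}

/-- The bracket at `k` is an opening bracket (an upward step of the Dyck path): `k` has a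
through-string or is joined to a later point. Otherwise it is a closing bracket (a downward step). -/
def IsOpening (a : HalfDiagram n) (k : Fin n) : Prop := k ≤ a.partner k

instance (a : HalfDiagram n) (k : Fin n) : Decidable (a.IsOpening k) :=
  inferInstanceAs (Decidable (k ≤ a.partner k))

/-- The height `h_m(a)` of the Dyck path after `m` steps: the number of opening brackets minus the
number of closing brackets among the first `m` brackets. -/
def height (a : HalfDiagram n) (m : ℕ) : ℤ :=
  ∑ k : Fin n, if k.val < m then (if a.IsOpening k then 1 else -1) else 0

/-- The number `p` of arches; there are `n - 2p` through-strings. -/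
def numPairs (a : HalfDiagram n) : ℕ := (Finset.univ.filter fun k : Fin n => k < a.partner k).card

/-- The minimal diagram with its number of arches, whose restricted sequence is `(1, …, 1)`: the
height just before each closing bracket is `1`. -/
def IsMinimal (a : HalfDiagram n) : Prop := ∀ k : Fin n, ¬ a.IsOpening k → a.height k.val = 1

/-- The Dyck path of `a` has a minimum at the position `i + 1`: a downward step
followed by an upward step. -/
def HasMinimum (a : HalfDiagram n) (i : ℕ) (hi : i + 1 < n) : Prop :=
  ¬ a.IsOpening ⟨i, by omega⟩ ∧ a.IsOpening ⟨i + 1, hi⟩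

/-- `b` is the result of the box addition at position `i + 1` on `a`: `a` has a minimum there, and
the path of `b` arises by replacing the downward step by an upward one and the upward step after it
by a downward one. -/
structure IsBoxAddition (i : ℕ) (hi : i + 1 < n) (a b : HalfDiagram n) : Prop where
  hasMinimum : a.HasMinimum i hi
  opening : b.IsOpening ⟨i, by omega⟩
  closing : ¬ b.IsOpening ⟨i + 1, hi⟩
  other : ∀ k : Fin n, k.val ≠ i → k.val ≠ i + 1 → (b.IsOpening k ↔ a.IsOpening k)

end HalfDiagram

/-- The value at `q` of the `k`-th Chebyshev polynomial, with `Δ₋₁ = 0`, `Δ₀ = 1` and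
`Δₖ₊₁ = q Δₖ - Δₖ₋₁`. -/
noncomputable def chebDelta (q : ℝ) (k : ℤ) : ℝ := (Polynomial.Chebyshev.S ℝ k).eval q

/-- `μₖ = Δₖ₋₁ / Δₖ`. -/
noncomputable def chebMu (q : ℝ) (k : ℤ) : ℝ := chebDelta q (k - 1) / chebDelta q k

/-- The quotients `μ` that occur in white box additions on half-diagrams on `n` points with `p`
arches are well-defined at `q`. -/
def MuDefined (q : ℝ) (n p : ℕ) : Prop :=
  ∀ (a : HalfDiagram n) (i : ℕ) (hi : i + 1 < n), a.numPairs = p → a.HasMinimum i hi →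
    chebDelta q (a.height (i + 1) + 1) ≠ 0

/-- `IsWhiteBox q a v`: the vector `v` of `U(n)` is obtained as `ξ'_a`, that is, from the basis element
of a minimal diagram by a sequence of white box additions that leads to `a`. -/
inductive IsWhiteBox {n : ℕ} (q : ℝ) : HalfDiagram n → HalfSpace n → Prop
  | minimal (a : HalfDiagram n) (ha : a.IsMinimal) : IsWhiteBox q a (Finsupp.single a 1)
  | box (a b : HalfDiagram n) (v : HalfSpace n) (i : ℕ) (hi : i + 1 < n)
      (hv : IsWhiteBox q a v) (hab : HalfDiagram.IsBoxAddition i hi a b) :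
      IsWhiteBox q b (tlAct q (tlGen i hi) v - (chebMu q (a.height (i + 1) + 1) : ℂ) • v)

/-!
Two different box additions with the same result take place at distant positions, so they are
completed to a diamond by two further ones. There the factors `e_i - μ` commute because the heights
involved agree, whence `ξ'_a` does not depend on the sequence of box additions.

The generators `e_i` are self-adjoint for the form. By `e_i e_j e_i = e_i` for `|i - j| = 1` and
`μ_{k+1} (q - μ_k) = 1`, the vector `e_i ξ'_a` is `0` if the Dyck path of `a` has two steps in the
same direction at `i`, it is `q ξ'_a` at a peak that rises from height `0`, and otherwise it is a
combination of `ξ'_a` and the vector of the diagram that differs from `a` by a box at `i`. Moving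
the last box of `b` to the other side of `⟨ξ'_a, ξ'_b⟩` reduces orthogonality to smaller `b`. For
minimal `b`, the paths of `a` and `b` part where one has a peak and the other two steps upwards,
and either the last box of `a` there can be moved, or `ξ'_a` and `ξ'_b` are eigenvectors of `e_i`
with the eigenvalues `0` and `q`.
-/

section joinPair

variable {ι : Type*} [DecidableEq ι] {u v w u' v' : ι} {α : ι → ι}

/-- The involution left by surgery on the involution `α`: the points `u` and `v` are joined to each
other, and so are their former partners. If just one of `u`, `v` is a fixed point of `α`, the former
partner of the other one becomes a fixed point. -/
def joinPair (u v : ι) (α : ι → ι) (k : ι) : ι :=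
  if k = u then v else if k = v then u
  else if k = α u then (if α v = v then k else α v)
  else if k = α v then (if α u = u then k else α u)
  else α k

theorem joinPair_comm (u v : ι) (α : ι → ι) : joinPair u v α = joinPair v u α := by
  funext k
  grind [joinPair]

@[simp]
theorem joinPair_left (u v : ι) (α : ι → ι) : joinPair u v α u = v := by
  simp [joinPair]

@[simp]
theorem joinPair_right (u v : ι) (α : ι → ι) : joinPair u v α v = u := by
  rw [joinPair_comm, joinPair_left]

theorem joinPair_of_ne {k : ι} (hα : Function.Involutive α) (hu : k ≠ u) (hv : k ≠ v)
    (hu' : α k ≠ u) (hv' : α k ≠ v) : joinPair u v α k = α k := by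
  grind [joinPair, Function.Involutive]

theorem involutive_joinPair (hα : Function.Involutive α) :
    Function.Involutive (joinPair u v α) := fun k ↦ by
  grind [joinPair, Function.Involutive]

theorem joinPair_eq_self (hα : Function.Involutive α) (h : α u = v) : joinPair u v α = α := by
  funext k
  grind [joinPair, Function.Involutive]

theorem joinPair_joinPair_eq_self (hα : Function.Involutive α) (huv : u ≠ v) (huw : u ≠ w)
    (hvw : v ≠ w) (h : α u = v) : joinPair u v (joinPair v w α) = α := by
  funext k
  grind [joinPair, Function.Involutive]

theorem joinPair_joinPair_comm (hα : Function.Involutive α) (huv : u ≠ v) (huv' : u' ≠ v')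
    (huu' : u ≠ u') (hu : u ≠ v') (hv : v ≠ u') (hvv' : v ≠ v') :
    joinPair u v (joinPair u' v' α) = joinPair u' v' (joinPair u v α) := by
  funext k
  grind (splits := 40) [joinPair, Function.Involutive]

end joinPair

section PairsBetween

variable {ι : Type*} {u v s t : ι} {α : ι → ι}

/-- The map `α` pairs the points strictly between `s` and `t` among themselves. An involution `α`
on a linear order describes a half-diagram if it does so between `s` and `α s` for every `s`; there
are no such points if `α s ≤ s`. -/
def PairsBetween [LT ι] (α : ι → ι) (s t : ι) : Prop :=
  ∀ z, s < z → z < t → s < α z ∧ α z < t ∧ α z ≠ z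

theorem PairsBetween.joinPair [LT ι] [DecidableEq ι] (hα : Function.Involutive α) (huv : u ≠ v)
    (h : PairsBetween α s t) (hmem : s < u ∧ u < t ↔ s < v ∧ v < t) :
    PairsBetween (joinPair u v α) s t := by
  intro z hsz hzt
  have := h z hsz hzt
  have := h u
  have := h v
  grind [_root_.joinPair, Function.Involutive]

variable [LinearOrder ι]

theorem pairsBetween_joinPair_partner_left (hα : Function.Involutive α)
    (h : ∀ s, PairsBetween α s (α s)) (huv : u < v) (hbetween : PairsBetween α u v)
    (hu : α u ≠ u) (hv : α v ≠ v) : PairsBetween (joinPair u v α) (α u) (α v) := by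
  intro z hsz hzt
  have houtside : α u < u ∧ v < α v := by
    have := h u v
    have := h (α u) v
    have := h (α v) u
    have := hbetween (α u)
    have := hbetween (α v)
    grind +splitImp [Function.Involutive]
  have := h (α u) z
  have := hbetween z
  have := h v z
  grind +splitImp [joinPair, Function.Involutive]

theorem pairsBetween_joinPair_partner_right (hα : Function.Involutive α)
    (h : ∀ s, PairsBetween α s (α s)) (huv : u < v) (hbetween : PairsBetween α u v)
    (hu : α u ≠ u) (hv : α v ≠ v) (hvu : α v ≠ u) : PairsBetween (joinPair u v α) (α v) (α u) := by
  intro z hsz hzt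
  have hsameSide : v < α v ∨ α u < u := by
    have := h (α v) u
    have := hbetween (α u)
    have := hbetween (α v)
    grind +splitImp [Function.Involutive]
  have := hbetween (α z)
  rcases hsameSide with hv | hu
  · have := h u z
    have := h v (α z)
    grind +splitImp [joinPair, Function.Involutive]
  · have := h (α v) z
    have := h (α u) (α z)
    grind +splitImp [joinPair, Function.Involutive]

theorem pairsBetween_joinPair (hα : Function.Involutive α) (h : ∀ s, PairsBetween α s (α s))
    (huv : u < v) (hbetween : PairsBetween α u v) (s : ι) :
    PairsBetween (joinPair u v α) s (joinPair u v α s) := by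
  by_cases hs : joinPair u v α s = s
  · exact fun z hsz hzs ↦ absurd (hsz.trans hzs) (by simp [hs])
  by_cases hsu : s = u
  · subst hsu
    rw [joinPair_left]
    exact hbetween.joinPair hα huv.ne (by simp)
  by_cases hsv : s = v
  · subst hsv
    rw [joinPair_right]
    exact fun z hz hz' ↦ absurd (hz.trans hz') huv.not_gt
  by_cases hsu' : α s = u
  · obtain ⟨rfl, hu, hv, ht⟩ : s = α u ∧ α u ≠ u ∧ α v ≠ v ∧ joinPair u v α s = α v := by
      grind [joinPair, Function.Involutive]
    exact ht ▸ pairsBetween_joinPair_partner_left hα h huv hbetween hu hv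
  by_cases hsv' : α s = v
  · obtain ⟨rfl, hu, hv, ht⟩ : s = α v ∧ α u ≠ u ∧ α v ≠ v ∧ joinPair u v α s = α u := by
      grind [joinPair, Function.Involutive]
    exact ht ▸ pairsBetween_joinPair_partner_right hα h huv hbetween hu hv hsu
  rw [joinPair_of_ne hα hsu hsv hsu' hsv']
  refine (h s).joinPair hα huv.ne ?_
  have := hbetween s
  have := hbetween (α s)
  grind [Function.Involutive]

end PairsBetween

section points

variable {n i : ℕ}

/-- The first one of the two adjacent points at which the generator `e_{i+1}` acts. -/
def fstPoint (hi : i + 1 < n) : Fin n := ⟨i, by omega⟩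

/-- The second one of the two adjacent points at which the generator `e_{i+1}` acts. -/
def sndPoint (hi : i + 1 < n) : Fin n := ⟨i + 1, hi⟩

@[simp]
theorem val_fstPoint (hi : i + 1 < n) : (fstPoint hi).val = i := rfl

@[simp]
theorem val_sndPoint (hi : i + 1 < n) : (sndPoint hi).val = i + 1 := rfl

theorem fstPoint_lt_sndPoint (hi : i + 1 < n) : fstPoint hi < sndPoint hi :=
  Nat.lt_succ_self i

theorem sndPoint_le_iff (hi : i + 1 < n) {k : Fin n} : sndPoint hi ≤ k ↔ fstPoint hi < k :=
  Iff.rfl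

theorem fstPoint_ne_sndPoint (hi : i + 1 < n) : fstPoint hi ≠ sndPoint hi :=
  (fstPoint_lt_sndPoint hi).ne

theorem pairsBetween_fstPoint_sndPoint (hi : i + 1 < n) (α : Fin n → Fin n) :
    PairsBetween α (fstPoint hi) (sndPoint hi) := fun _ hz hz' ↦
  absurd ((sndPoint_le_iff hi).2 hz) hz'.not_ge

end points

namespace HalfDiagram

variable {n i j : ℕ} {hi : i + 1 < n} {hj : j + 1 < n} {a b c : HalfDiagram n}

theorem involutive_partner (a : HalfDiagram n) : Function.Involutive a.partner :=
  a.partner_partner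

theorem pairsBetween_partner (a : HalfDiagram n) (s : Fin n) :
    PairsBetween a.partner s (a.partner s) := by
  intro z hsz hz
  have := a.arch_arch s z
  have := a.arch_arch (a.partner z) s
  have := a.arch_through s z
  have := a.partner_partner s
  have := a.partner_partner z
  grind

/-- The half-diagram obtained from `a` by the surgery `joinPair` at two points `u < v` such that `a`
pairs the points between them among themselves. -/
def join (a : HalfDiagram n) {u v : Fin n} (huv : u < v) (h : PairsBetween a.partner u v) :
    HalfDiagram n where
  partner := joinPair u v a.partner
  partner_partner := involutive_joinPair a.involutive_partner
  arch_arch s z := fun ⟨hsz, hz, hlt⟩ ↦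
    (pairsBetween_joinPair a.involutive_partner a.pairsBetween_partner huv h s z hsz hz).2.1.not_gt
      hlt
  arch_through s z := fun ⟨hsz, hz, hfix⟩ ↦
    (pairsBetween_joinPair a.involutive_partner a.pairsBetween_partner huv h s z hsz hz).2.2 hfix

/-- The half-diagram left by the generator `e_{i+1}` on `a`. -/
def cap (a : HalfDiagram n) (hi : i + 1 < n) : HalfDiagram n :=
  a.join (fstPoint_lt_sndPoint hi) (pairsBetween_fstPoint_sndPoint hi _)

theorem partner_cap (a : HalfDiagram n) (hi : i + 1 < n) :
    (a.cap hi).partner = joinPair (fstPoint hi) (sndPoint hi) a.partner := rfl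

@[simp]
theorem partner_cap_fstPoint (a : HalfDiagram n) (hi : i + 1 < n) :
    (a.cap hi).partner (fstPoint hi) = sndPoint hi :=
  joinPair_left _ _ _

@[simp]
theorem partner_cap_sndPoint (a : HalfDiagram n) (hi : i + 1 < n) :
    (a.cap hi).partner (sndPoint hi) = fstPoint hi :=
  joinPair_right _ _ _

theorem not_partner_lt_partner (hab : ∀ k, a.IsOpening k ↔ b.IsOpening k) {k : Fin n}
    (hlt : ∀ j < k, ¬ a.IsOpening j → a.partner j = b.partner j) (hk : ¬ a.IsOpening k) :
    ¬ a.partner k < b.partner k := by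
  intro hak
  have := (hab k).not.1 hk
  have := hab (b.partner k)
  have := hlt (a.partner (b.partner k))
  have := a.pairsBetween_partner (a.partner k) (b.partner k)
  have := a.involutive_partner
  have := b.involutive_partner
  grind [IsOpening, Function.Involutive]

theorem partner_eq_partner_of_not_isOpening (hab : ∀ k, a.IsOpening k ↔ b.IsOpening k) (k : Fin n)
    (hk : ¬ a.IsOpening k) : a.partner k = b.partner k := by
  induction k using WellFoundedLT.induction with
  | ind k ih =>
    refine le_antisymm (not_lt.1 ?_) (not_lt.1 (not_partner_lt_partner hab ih hk))
    exact not_partner_lt_partner (fun k ↦ (hab k).symm)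
      (fun j hj hbj ↦ (ih j hj ((hab j).not.2 hbj)).symm) ((hab k).not.1 hk)

theorem ext_of_isOpening (hab : ∀ k, a.IsOpening k ↔ b.IsOpening k) : a = b := by
  have hclosing := partner_eq_partner_of_not_isOpening hab
  ext1
  funext k
  have := hclosing k
  have := hclosing (a.partner k)
  have := hclosing (b.partner k)
  have := hab k
  have := hab (b.partner k)
  have := a.involutive_partner
  have := b.involutive_partner
  grind [IsOpening, Function.Involutive]

/-- The Dyck path of `a` has a maximum at the position `i + 1`. -/
def HasPeak (a : HalfDiagram n) (hi : i + 1 < n) : Prop :=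
  a.IsOpening (fstPoint hi) ∧ ¬ a.IsOpening (sndPoint hi)

theorem hasMinimum_iff :
    a.HasMinimum i hi ↔ ¬ a.IsOpening (fstPoint hi) ∧ a.IsOpening (sndPoint hi) := Iff.rfl

theorem HasPeak.partner_eq (h : a.HasPeak hi) : a.partner (fstPoint hi) = sndPoint hi := by
  have := a.pairsBetween_partner (a.partner (sndPoint hi)) (fstPoint hi)
  have := a.partner_partner
  have := fstPoint_lt_sndPoint hi
  have := sndPoint_le_iff hi (k := a.partner (fstPoint hi))
  have := sndPoint_le_iff hi (k := a.partner (sndPoint hi))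
  grind [HasPeak, IsOpening]

theorem cap_eq_self (h : a.partner (fstPoint hi) = sndPoint hi) : a.cap hi = a :=
  HalfDiagram.ext (joinPair_eq_self a.involutive_partner h)

theorem isBoxAddition_iff : IsBoxAddition i hi a b ↔ a.HasMinimum i hi ∧
    ∀ k, b.IsOpening k ↔ a.IsOpening (Equiv.swap (fstPoint hi) (sndPoint hi) k) := by
  refine ⟨fun h ↦ ⟨h.hasMinimum, fun k ↦ ?_⟩, fun ⟨hmin, h⟩ ↦ ⟨hmin, ?_, ?_, fun k hk hk' ↦ ?_⟩⟩
  · obtain rfl | hk := eq_or_ne k (fstPoint hi)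
    · rw [Equiv.swap_apply_left]
      exact iff_of_true h.opening h.hasMinimum.2
    obtain rfl | hk' := eq_or_ne k (sndPoint hi)
    · rw [Equiv.swap_apply_right]
      exact iff_of_false h.closing h.hasMinimum.1
    rw [Equiv.swap_apply_of_ne_of_ne hk hk']
    exact h.other k (fun h ↦ hk (Fin.ext h)) (fun h ↦ hk' (Fin.ext h))
  · exact (h (fstPoint hi)).2 ((Equiv.swap_apply_left _ (sndPoint hi)).symm ▸ hmin.2)
  · exact (h (sndPoint hi)).not.2 ((Equiv.swap_apply_right (fstPoint hi) _).symm ▸ hmin.1)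
  · rw [h, Equiv.swap_apply_of_ne_of_ne] <;> rintro rfl <;> simp at hk hk'

theorem IsBoxAddition.isOpening_iff (h : IsBoxAddition i hi a b) (k : Fin n) :
    b.IsOpening k ↔ a.IsOpening (Equiv.swap (fstPoint hi) (sndPoint hi) k) :=
  (isBoxAddition_iff.1 h).2 k

theorem IsBoxAddition.isOpening_iff' (h : IsBoxAddition i hi a b) (k : Fin n) :
    a.IsOpening k ↔ b.IsOpening (Equiv.swap (fstPoint hi) (sndPoint hi) k) := by
  rw [h.isOpening_iff, Equiv.swap_apply_self]

theorem IsBoxAddition.hasPeak (h : IsBoxAddition i hi a b) : b.HasPeak hi :=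
  ⟨h.opening, h.closing⟩

theorem IsBoxAddition.unique_right (hb : IsBoxAddition i hi a b) (hc : IsBoxAddition i hi a c) :
    b = c :=
  ext_of_isOpening fun k ↦ (hb.isOpening_iff k).trans (hc.isOpening_iff k).symm

theorem IsBoxAddition.unique_left (ha : IsBoxAddition i hi a c) (hb : IsBoxAddition i hi b c) :
    a = b :=
  ext_of_isOpening fun k ↦ (ha.isOpening_iff' k).trans (hb.isOpening_iff' k).symm

theorem isBoxAddition_cap (h : a.HasMinimum i hi) : IsBoxAddition i hi a (a.cap hi) := by
  refine isBoxAddition_iff.2 ⟨h, fun k ↦ ?_⟩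
  rw [hasMinimum_iff] at h
  have := a.involutive_partner
  have := fstPoint_lt_sndPoint hi
  have := sndPoint_le_iff hi (k := k)
  simp only [IsOpening, partner_cap, Equiv.swap_apply_def] at h ⊢
  grind [joinPair, Function.Involutive]

theorem exists_last_open_point (b : HalfDiagram n) {u x : Fin n}
    (hxu : x < u) (hx : b.partner x = x ∨ u ≤ b.partner x) :
    ∃ y < u, (b.partner y = y ∨ u ≤ b.partner y) ∧ PairsBetween b.partner y u := by
  obtain ⟨y, ⟨hyu, hy⟩, hmax⟩ :=
    (Set.toFinite {x | x < u ∧ (b.partner x = x ∨ u ≤ b.partner x)}).exists_maximal ⟨x, hxu, hx⟩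
  refine ⟨y, hyu, hy, fun z hyz hzu ↦ ?_⟩
  have hz : b.partner z ≠ z ∧ b.partner z < u := by
    by_contra hz
    have := @hmax z ⟨hzu, by grind⟩ hyz.le
    exact hyz.not_ge this
  have := b.pairsBetween_partner (b.partner z) y
  have := b.partner_partner
  grind

theorem exists_isBoxAddition_of_hasPeak (h : b.HasPeak hi) {x : Fin n} (hxi : x < fstPoint hi)
    (hx : b.partner x = x ∨ fstPoint hi ≤ b.partner x) : ∃ a, IsBoxAddition i hi a b := by
  -- Removing the box joins the first point of the peak to the last open point before it.
  obtain ⟨y, hyi, hy, hbetween⟩ := b.exists_last_open_point hxi hx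
  have huv := h.partner_eq
  have hpartner : (b.join hyi hbetween).partner = joinPair (fstPoint hi) y b.partner := by
    rw [joinPair_comm]
    rfl
  have hmin : (b.join hyi hbetween).HasMinimum i hi := by
    have := fstPoint_lt_sndPoint hi
    have := b.involutive_partner
    rw [hasMinimum_iff, IsOpening, IsOpening, sndPoint_le_iff, hpartner]
    grind [joinPair, Function.Involutive]
  refine ⟨b.join hyi hbetween, ?_⟩
  convert isBoxAddition_cap hmin
  refine HalfDiagram.ext ?_
  rw [partner_cap, hpartner, joinPair_comm (fstPoint hi), joinPair_joinPair_eq_self]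
  · exact b.involutive_partner
  · exact (fstPoint_ne_sndPoint hi).symm
  · exact (hyi.trans (fstPoint_lt_sndPoint hi)).ne'
  · exact hyi.ne'
  · rw [← huv, b.partner_partner]

@[simp]
theorem height_zero (a : HalfDiagram n) : a.height 0 = 0 := by
  simp [height]

theorem height_succ (a : HalfDiagram n) (k : Fin n) :
    a.height (k.val + 1) = a.height k.val + if a.IsOpening k then 1 else -1 := by
  unfold height
  rw [← sub_eq_iff_eq_add', ← Finset.sum_sub_distrib, Finset.sum_eq_single k]
  · simp
  · intro j _ hj
    have : j.val ≠ k.val := Fin.val_ne_of_ne hj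
    split_ifs <;> omega
  · simp

theorem height_succ_of_isOpening {k : Fin n} (h : a.IsOpening k) :
    a.height (k.val + 1) = a.height k.val + 1 := by
  rw [height_succ, if_pos h]

theorem height_succ_of_not_isOpening {k : Fin n} (h : ¬ a.IsOpening k) :
    a.height (k.val + 1) = a.height k.val - 1 := by
  rw [height_succ, if_neg h, sub_eq_add_neg]

theorem height_congr {m : ℕ} (h : ∀ k : Fin n, k.val < m → (a.IsOpening k ↔ b.IsOpening k)) :
    a.height m = b.height m := by
  refine Finset.sum_congr rfl fun k _ ↦ ?_
  by_cases hk : k.val < m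
  · simp only [h k hk]
  · simp only [hk, if_false]

/-- The points before `m` that carry a through-string or are joined to a point not before `m`. -/
def openPoints (a : HalfDiagram n) (m : ℕ) : Finset (Fin n) :=
  Finset.univ.filter fun k ↦ k.val < m ∧ (a.partner k = k ∨ m ≤ (a.partner k).val)

theorem mem_openPoints {m : ℕ} {k : Fin n} :
    k ∈ a.openPoints m ↔ k.val < m ∧ (a.partner k = k ∨ m ≤ (a.partner k).val) := by
  simp [openPoints]

theorem height_eq_card_openPoints (a : HalfDiagram n) (m : ℕ) :
    a.height m = (a.openPoints m).card := by
  rw [openPoints, Finset.card_filter, Nat.cast_sum, ← sub_eq_zero, height,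
    ← Finset.sum_sub_distrib]
  -- The contributions of two points joined by an arch cancel.
  refine Finset.sum_involution (fun k _ ↦ a.partner k) (fun k _ ↦ ?_) (fun k _ hk hfix ↦ ?_)
    (by simp) (fun k _ ↦ a.partner_partner k)
  · have : a.IsOpening (a.partner k) ↔ a.partner k ≤ k := by rw [IsOpening, a.partner_partner]
    rw [a.partner_partner]
    grind [IsOpening]
  · grind [IsOpening]

theorem height_nonneg (a : HalfDiagram n) (m : ℕ) : 0 ≤ a.height m := by
  rw [height_eq_card_openPoints]
  positivity

theorem height_pos_of_not_isOpening {k : Fin n} (h : ¬ a.IsOpening k) : 0 < a.height k.val := by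
  have := height_succ_of_not_isOpening h
  have := a.height_nonneg (k.val + 1)
  omega

theorem exists_isBoxAddition_of_height_pos (h : b.HasPeak hi) (hpos : 0 < b.height i) :
    ∃ a, IsBoxAddition i hi a b := by
  rw [height_eq_card_openPoints, Nat.cast_pos, Finset.card_pos] at hpos
  obtain ⟨x, hx⟩ := hpos
  rw [mem_openPoints] at hx
  exact exists_isBoxAddition_of_hasPeak h hx.1 hx.2

theorem IsBoxAddition.height_eq (h : IsBoxAddition i hi a b) {m : ℕ} (hm : m ≠ i + 1) :
    b.height m = a.height m := by
  unfold height
  rw [← Equiv.sum_comp (Equiv.swap (fstPoint hi) (sndPoint hi))]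
  refine Finset.sum_congr rfl fun k _ ↦ ?_
  have hlt : (Equiv.swap (fstPoint hi) (sndPoint hi) k).val < m ↔ k.val < m := by
    have := val_fstPoint hi
    have := val_sndPoint hi
    grind
  simp only [hlt, ← h.isOpening_iff' k]

theorem numPairs_eq_card_not_isOpening (a : HalfDiagram n) :
    a.numPairs = (Finset.univ.filter fun k : Fin n ↦ ¬ a.IsOpening k).card := by
  refine Finset.card_nbij' a.partner a.partner ?_ ?_ (fun k _ ↦ a.partner_partner k)
    (fun k _ ↦ a.partner_partner k)
  all_goals
    intro k hk
    simpa [IsOpening, a.partner_partner] using hk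

theorem IsBoxAddition.numPairs_eq (h : IsBoxAddition i hi a b) : b.numPairs = a.numPairs := by
  rw [numPairs_eq_card_not_isOpening, numPairs_eq_card_not_isOpening]
  exact Finset.card_equiv (Equiv.swap (fstPoint hi) (sndPoint hi)) fun k ↦ by
    simp [h.isOpening_iff k]

/-- The sum of the positions of the closing brackets, a measure that each box addition increases. -/
def closingSum (a : HalfDiagram n) : ℕ :=
  ∑ k : Fin n, if a.IsOpening k then 0 else k.val

theorem IsBoxAddition.closingSum_lt (h : IsBoxAddition i hi a b) :
    a.closingSum < b.closingSum := by
  unfold closingSum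
  rw [← Equiv.sum_comp (Equiv.swap (fstPoint hi) (sndPoint hi))
    (fun k ↦ if b.IsOpening k then 0 else k.val)]
  simp only [← h.isOpening_iff']
  have hmin := hasMinimum_iff.1 h.hasMinimum
  refine Finset.sum_lt_sum (fun k _ ↦ ?_) ⟨fstPoint hi, Finset.mem_univ _, ?_⟩
  · have := val_fstPoint hi
    have := val_sndPoint hi
    grind
  · simp [hmin.1]

theorem fstPoint_ne_of_far (hij : i + 1 < j ∨ j + 1 < i) : fstPoint hi ≠ fstPoint hj ∧
    fstPoint hi ≠ sndPoint hj ∧ sndPoint hi ≠ fstPoint hj ∧ sndPoint hi ≠ sndPoint hj := by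
  simp only [ne_eq, Fin.ext_iff, val_fstPoint, val_sndPoint]
  omega

theorem IsBoxAddition.isOpening_iff_of_far (h : IsBoxAddition i hi a b)
    (hij : i + 1 < j ∨ j + 1 < i) :
    (b.IsOpening (fstPoint hj) ↔ a.IsOpening (fstPoint hj)) ∧
      (b.IsOpening (sndPoint hj) ↔ a.IsOpening (sndPoint hj)) := by
  have hne := fstPoint_ne_of_far (hi := hi) (hj := hj) hij
  rw [h.isOpening_iff, h.isOpening_iff, Equiv.swap_apply_of_ne_of_ne hne.1.symm hne.2.2.1.symm,
    Equiv.swap_apply_of_ne_of_ne hne.2.1.symm hne.2.2.2.symm]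
  exact ⟨Iff.rfl, Iff.rfl⟩

theorem HasPeak.far_of_ne (hpi : a.HasPeak hi) (hpj : a.HasPeak hj) (hij : i ≠ j) :
    i + 1 < j ∨ j + 1 < i := by
  have hi' : i + 1 ≠ j := by
    rintro rfl
    exact hpi.2 hpj.1
  have hj' : j + 1 ≠ i := by
    rintro rfl
    exact hpj.2 hpi.1
  omega

theorem swap_swap_comm_of_far (hij : i + 1 < j ∨ j + 1 < i) (k : Fin n) :
    Equiv.swap (fstPoint hi) (sndPoint hi) (Equiv.swap (fstPoint hj) (sndPoint hj) k) =
      Equiv.swap (fstPoint hj) (sndPoint hj) (Equiv.swap (fstPoint hi) (sndPoint hi) k) := by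
  have := fstPoint_ne_of_far (hi := hi) (hj := hj) hij
  grind

theorem IsBoxAddition.diamond (ha : IsBoxAddition i hi a c) (hb : IsBoxAddition j hj b c)
    (hij : i ≠ j) : ∃ d, IsBoxAddition j hj d a ∧ IsBoxAddition i hi d b := by
  have hfar := ha.hasPeak.far_of_ne hb.hasPeak hij
  have hpeak : a.HasPeak hj := by
    rw [HasPeak, ← (ha.isOpening_iff_of_far hfar).1, ← (ha.isOpening_iff_of_far hfar).2]
    exact hb.hasPeak
  have hpos : 0 < a.height j := by
    rw [← ha.height_eq (by omega), hb.height_eq (by omega)]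
    exact height_pos_of_not_isOpening hb.hasMinimum.1
  obtain ⟨d, hd⟩ := exists_isBoxAddition_of_height_pos hpeak hpos
  refine ⟨d, hd, isBoxAddition_iff.2 ⟨?_, fun k ↦ ?_⟩⟩
  · rw [hasMinimum_iff, ← (hd.isOpening_iff_of_far hfar.symm).1,
      ← (hd.isOpening_iff_of_far hfar.symm).2]
    exact ha.hasMinimum
  · rw [hb.isOpening_iff', ha.isOpening_iff, hd.isOpening_iff, swap_swap_comm_of_far hfar,
      Equiv.swap_apply_self]

theorem IsMinimal.not_isBoxAddition (hb : b.IsMinimal) : ¬ IsBoxAddition i hi a b := by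
  intro h
  have := hb _ h.closing
  have := height_succ_of_isOpening h.opening
  have := h.height_eq (m := i) (by omega)
  have := height_pos_of_not_isOpening h.hasMinimum.1
  simp only at *
  omega

theorem exists_isBoxAddition_of_not_isMinimal (hb : ¬ b.IsMinimal) :
    ∃ (i : ℕ) (hi : i + 1 < n) (a : HalfDiagram n), IsBoxAddition i hi a b := by
  have hne : {k : Fin n | ¬ b.IsOpening k ∧ b.height k ≠ 1}.Nonempty := by
    simpa [IsMinimal, Set.Nonempty] using hb
  obtain ⟨⟨k, hkn⟩, ⟨hk, hk1⟩, hfirst⟩ := (Set.toFinite _).exists_minimal hne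
  have hpos := height_pos_of_not_isOpening hk
  obtain _ | i := k
  · simp at hpos
  have hopening : b.IsOpening (fstPoint hkn) := by
    by_contra hclosing
    have hheight := height_succ_of_not_isOpening hclosing
    have := hfirst ⟨hclosing, by simp only [val_fstPoint] at hheight ⊢ hpos; omega⟩
      (fstPoint_lt_sndPoint hkn).le
    exact (fstPoint_lt_sndPoint hkn).not_ge this
  have hheight := height_succ_of_isOpening hopening
  obtain ⟨a, ha⟩ := exists_isBoxAddition_of_height_pos ⟨hopening, hk⟩
    (by simp only [val_fstPoint] at hheight hpos hk1; omega)
  exact ⟨i, hkn, a, ha⟩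

@[elab_as_elim]
theorem box_induction {motive : HalfDiagram n → Prop} (a : HalfDiagram n)
    (minimal : ∀ a, a.IsMinimal → motive a)
    (box : ∀ (i : ℕ) (hi : i + 1 < n) (a b : HalfDiagram n), IsBoxAddition i hi a b →
      (∀ c, c.closingSum < b.closingSum → motive c) → motive b) :
    motive a := by
  induction h : a.closingSum using Nat.strong_induction_on generalizing a with
  | _ m ih =>
    by_cases ha : a.IsMinimal
    · exact minimal a ha
    · obtain ⟨i, hi, c, hc⟩ := exists_isBoxAddition_of_not_isMinimal ha
      exact box i hi c a hc fun d hd ↦ ih _ (h ▸ hd) d rfl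

theorem IsMinimal.isOpening_sndPoint (ha : a.IsMinimal) (h : ¬ a.IsOpening (fstPoint hi)) :
    a.IsOpening (sndPoint hi) := by
  by_contra h'
  have := ha _ h
  have := ha _ h'
  have := height_succ_of_not_isOpening h
  simp only [val_fstPoint, val_sndPoint] at *
  omega

theorem IsMinimal.eq_of_mem_openPoints (ha : a.IsMinimal) {s t w : Fin n}
    (hw : ¬ a.IsOpening w) (hs : s ∈ a.openPoints w) (ht : t ∈ a.openPoints w) : s = t := by
  have hcard := ha w hw
  rw [height_eq_card_openPoints, Nat.cast_eq_one] at hcard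
  exact Finset.card_le_one.1 hcard.le s hs t ht

theorem IsMinimal.partner_eq_self (ha : a.IsMinimal) (hu : a.IsOpening (fstPoint hi))
    (hv : a.IsOpening (sndPoint hi)) :
    a.partner (fstPoint hi) = fstPoint hi ∧ a.partner (sndPoint hi) = sndPoint hi := by
  have hlt := fstPoint_lt_sndPoint hi
  have hnot : ∀ w, ¬ a.IsOpening w → fstPoint hi ∈ a.openPoints w → sndPoint hi ∉ a.openPoints w :=
    fun w hw hmem hmem' ↦ hlt.ne (ha.eq_of_mem_openPoints hw hmem hmem')
  simp only [mem_openPoints, ← Fin.lt_def, ← Fin.le_def] at hnot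
  have := hnot (a.partner (sndPoint hi))
  have := hnot (a.partner (fstPoint hi))
  have := sndPoint_le_iff hi (k := a.partner (fstPoint hi))
  have := a.pairsBetween_partner (fstPoint hi) (sndPoint hi)
  have := a.partner_partner
  grind [IsOpening]

end HalfDiagram

section pushAway

variable {ι : Type*} [DecidableEq ι] {u v : ι} {α : ι → ι} {S : ι → ι → Prop}

theorem rel_joinPair (hS : Equivalence S) (huv : S u v) (h : ∀ k, S k (α k)) (k : ι) :
    S k (joinPair u v α k) := by
  unfold joinPair
  split_ifs with h₁ h₂ h₃ h₄ h₅ h₆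
  · exact h₁ ▸ huv
  · exact h₂ ▸ hS.symm huv
  · exact hS.refl k
  · exact h₃ ▸ hS.trans (hS.symm (h u)) (hS.trans huv (h v))
  · exact hS.refl k
  · exact h₅ ▸ hS.trans (hS.symm (h v)) (hS.trans (hS.symm huv) (h u))
  · exact h k

/-- The map that moves `u` and `v` to a point that is paired with one of them by the involution `α`,
and fixes all other points. Unless `α` exchanges or fixes both `u` and `v`, that point differs from
`u` and `v`. -/
def pushAway (u v : ι) (α : ι → ι) (k : ι) : ι :=
  if k = u ∨ k = v then (if α u = u then α v else α u) else k

theorem pushAway_of_ne {k : ι} (hu : k ≠ u) (hv : k ≠ v) : pushAway u v α k = k :=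
  if_neg (not_or.2 ⟨hu, hv⟩)

theorem pushAway_right (u v : ι) (α : ι → ι) : pushAway u v α v = pushAway u v α u := by
  simp [pushAway]

theorem pushAway_ne (hα : Function.Involutive α) (harch : α u ≠ v)
    (hthrough : ¬ (α u = u ∧ α v = v)) (k : ι) :
    pushAway u v α k ≠ u ∧ pushAway u v α k ≠ v := by
  grind [pushAway, Function.Involutive]

theorem rel_pushAway (hS : Equivalence S) (huv : S u v) (h : ∀ k, S k (α k)) (k : ι) :
    S k (pushAway u v α k) := by
  have hrep : S u (if α u = u then α v else α u) := by
    split_ifs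
    · exact hS.trans huv (h v)
    · exact h u
  by_cases hk : k = u ∨ k = v
  · rw [pushAway, if_pos hk]
    obtain rfl | rfl := hk
    · exact hrep
    · exact hS.trans (hS.symm huv) hrep
  · rw [pushAway, if_neg hk]
    exact hS.refl k

theorem rel_pushAway_apply (hα : Function.Involutive α) (hS : Equivalence S)
    (h : ∀ k, S k (joinPair u v α k)) (k : ι) :
    S (pushAway u v α k) (pushAway u v α (α k)) := by
  have := h k
  have := h (α u)
  have := h (α v)
  have := hS.refl
  have := @hS.symm
  have := @hS.trans
  grind (splits := 30) [pushAway, joinPair, Function.Involutive]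

theorem bijOn_pushAway (hα : Function.Involutive α) (huv : u ≠ v)
    (hthrough : ¬ (α u = u ∧ α v = v)) :
    Set.BijOn (pushAway u v α) (Function.fixedPoints α)
      (Function.fixedPoints (joinPair u v α)) := by
  refine ⟨fun k hk ↦ ?_, fun k hk l hl hkl ↦ ?_, fun k hk ↦ ?_⟩
  · simp only [Function.mem_fixedPoints_iff] at hk ⊢
    grind [pushAway, joinPair, Function.Involutive]
  · simp only [Function.mem_fixedPoints_iff] at hk hl
    grind [pushAway, Function.Involutive]
  · simp only [Function.mem_fixedPoints_iff] at hk
    by_cases hk' : α k = k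
    · exact ⟨k, hk', by grind [pushAway, joinPair]⟩
    by_cases hu : α u = u
    · exact ⟨u, hu, by grind [pushAway, joinPair]⟩
    · exact ⟨v, Function.mem_fixedPoints_iff.2 (by grind [joinPair, Function.Involutive]),
        by grind [pushAway, joinPair]⟩

end pushAway

section fromRel

variable {V : Type*} {r : V → V → Prop} {x y : V}

theorem rel_of_reachable_fromRel {S : V → V → Prop} (hS : Equivalence S)
    (h : ∀ x y, r x y → S x y) (hxy : (SimpleGraph.fromRel r).Reachable x y) : S x y := by
  obtain ⟨w⟩ := hxy
  induction w with
  | nil => exact hS.refl _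
  | cons hadj _ ih =>
    rw [SimpleGraph.fromRel_adj] at hadj
    exact hS.trans (hadj.2.elim (h _ _) fun h' ↦ hS.symm (h _ _ h')) ih

theorem reachable_fromRel (h : r x y) : (SimpleGraph.fromRel r).Reachable x y := by
  obtain rfl | hxy := eq_or_ne x y
  · rfl
  · exact SimpleGraph.Adj.reachable ((SimpleGraph.fromRel_adj _ _ _).2 ⟨hxy, Or.inl h⟩)

end fromRel

section concat

variable {n i : ℕ} {hi : i + 1 < n} {a : HalfDiagram n} {x y : Fin n ⊕ Fin n}

theorem partner_tlGen_inl (hi : i + 1 < n) (k : Fin n) : (tlGen i hi).partner (Sum.inl k) =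
    if k = fstPoint hi then Sum.inl (sndPoint hi)
    else if k = sndPoint hi then Sum.inl (fstPoint hi) else Sum.inr k := by
  simp only [tlGen, fstPoint, sndPoint, Fin.ext_iff]

theorem partner_tlGen_inr (hi : i + 1 < n) (k : Fin n) : (tlGen i hi).partner (Sum.inr k) =
    if k = fstPoint hi then Sum.inr (sndPoint hi)
    else if k = sndPoint hi then Sum.inr (fstPoint hi) else Sum.inl k := by
  simp only [tlGen, fstPoint, sndPoint, Fin.ext_iff]

theorem rel_of_concat_reachable {S : Fin n ⊕ Fin n → Fin n ⊕ Fin n → Prop} (hS : Equivalence S)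
    (hleft : S (Sum.inl (fstPoint hi)) (Sum.inl (sndPoint hi)))
    (hright : S (Sum.inr (fstPoint hi)) (Sum.inr (sndPoint hi)))
    (hthrough : ∀ k, k ≠ fstPoint hi → k ≠ sndPoint hi → S (Sum.inl k) (Sum.inr k))
    (ha : ∀ k, S (Sum.inr k) (Sum.inr (a.partner k)))
    (hxy : (concatGraph (tlGen i hi) a).Reachable x y) : S x y := by
  refine rel_of_reachable_fromRel hS ?_ hxy
  have hsymm := @hS.symm
  rintro (k | k) y (rfl | ⟨l, hl, rfl⟩)
  · rw [partner_tlGen_inl]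
    grind
  · cases hl
  · rw [partner_tlGen_inr]
    grind
  · cases hl
    exact ha k

theorem concat_reachable_left (hi : i + 1 < n) (a : HalfDiagram n) :
    (concatGraph (tlGen i hi) a).Reachable (Sum.inl (fstPoint hi)) (Sum.inl (sndPoint hi)) :=
  reachable_fromRel (Or.inl (by rw [partner_tlGen_inl, if_pos rfl]))

theorem concat_reachable_right (hi : i + 1 < n) (a : HalfDiagram n) :
    (concatGraph (tlGen i hi) a).Reachable (Sum.inr (fstPoint hi)) (Sum.inr (sndPoint hi)) :=
  reachable_fromRel (Or.inl (by rw [partner_tlGen_inr, if_pos rfl]))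

theorem concat_reachable_through (a : HalfDiagram n) {k : Fin n} (hu : k ≠ fstPoint hi)
    (hv : k ≠ sndPoint hi) :
    (concatGraph (tlGen i hi) a).Reachable (Sum.inl k) (Sum.inr k) :=
  reachable_fromRel (Or.inl (by rw [partner_tlGen_inl, if_neg hu, if_neg hv]))

theorem concat_reachable_partner {p : TLDiagram n} (a : HalfDiagram n) (k : Fin n) :
    (concatGraph p a).Reachable (Sum.inr k) (Sum.inr (a.partner k)) :=
  reachable_fromRel (Or.inr ⟨k, rfl, rfl⟩)

theorem equivalence_concat_reachable_inr (p : TLDiagram n) (a : HalfDiagram n) :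
    Equivalence fun k l ↦ (concatGraph p a).Reachable (Sum.inr k) (Sum.inr l) :=
  ⟨fun _ ↦ .refl _, .symm, .trans⟩

namespace HalfDiagram

/-- The points `k` and `l` are equal or joined by an arch. -/
def SameBlock (a : HalfDiagram n) (k l : Fin n) : Prop := l = k ∨ l = a.partner k

theorem equivalence_sameBlock (a : HalfDiagram n) : Equivalence a.SameBlock := by
  have := a.partner_partner
  refine ⟨fun k ↦ ?_, fun h ↦ ?_, fun h h' ↦ ?_⟩ <;> grind [SameBlock]

theorem sameBlock_partner (a : HalfDiagram n) (k : Fin n) : a.SameBlock k (a.partner k) :=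
  Or.inr rfl

end HalfDiagram

theorem sameBlock_cap_of_concat_reachable (hxy : (concatGraph (tlGen i hi) a).Reachable x y) :
    (a.cap hi).SameBlock (Sum.elim id (pushAway (fstPoint hi) (sndPoint hi) a.partner) x)
      (Sum.elim id (pushAway (fstPoint hi) (sndPoint hi) a.partner) y) := by
  have hS := (a.cap hi).equivalence_sameBlock
  refine rel_of_concat_reachable (hS.comap _) ?_ ?_ (fun k hu hv ↦ ?_) (fun k ↦ ?_) hxy
  · exact Or.inr (a.partner_cap_fstPoint hi).symm
  · exact Or.inl (pushAway_right _ _ _)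
  · exact Or.inl (pushAway_of_ne hu hv)
  · exact rel_pushAway_apply a.involutive_partner hS (a.cap hi).sameBlock_partner k

theorem isConcat_cap : IsConcat (tlGen i hi) a (a.cap hi) := by
  refine fun s t hst ↦ ⟨?_, fun h ↦ ?_⟩
  · rintro rfl
    obtain rfl | hs := eq_or_ne s (fstPoint hi)
    · rw [HalfDiagram.partner_cap_fstPoint]
      exact concat_reachable_left hi a
    obtain rfl | hs' := eq_or_ne s (sndPoint hi)
    · rw [HalfDiagram.partner_cap_sndPoint]
      exact (concat_reachable_left hi a).symm
    have hright := rel_joinPair (equivalence_concat_reachable_inr _ a)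
      (concat_reachable_right hi a) (concat_reachable_partner a) s
    rw [← HalfDiagram.partner_cap] at hright
    refine (concat_reachable_through a hs hs').trans (hright.trans
      (concat_reachable_through a (fun h ↦ hs' ?_) (fun h ↦ hs ?_)).symm)
    · rw [← (a.cap hi).partner_partner s, h, HalfDiagram.partner_cap_fstPoint]
    · rw [← (a.cap hi).partner_partner s, h, HalfDiagram.partner_cap_sndPoint]
  · exact ((sameBlock_cap_of_concat_reachable h).resolve_left hst.symm).symm

theorem concatVanishes_iff : ConcatVanishes (tlGen i hi) a ↔
    a.partner (fstPoint hi) = fstPoint hi ∧ a.partner (sndPoint hi) = sndPoint hi := by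
  refine ⟨fun ⟨s, t, hst, hs, ht, hr⟩ ↦ ?_, fun h ↦
    ⟨_, _, fstPoint_ne_sndPoint hi, h.1, h.2, concat_reachable_right hi a⟩⟩
  by_contra hthrough
  have hbij := bijOn_pushAway a.involutive_partner (fstPoint_ne_sndPoint hi) hthrough
  refine hst (hbij.injOn hs ht ?_)
  obtain h | h := sameBlock_cap_of_concat_reachable hr
  · exact h.symm
  · exact (h.trans (hbij.mapsTo hs)).symm

theorem exists_concat_reachable_inl (harch : a.partner (fstPoint hi) ≠ sndPoint hi)
    (hthrough : ¬ (a.partner (fstPoint hi) = fstPoint hi ∧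
      a.partner (sndPoint hi) = sndPoint hi)) (x : Fin n ⊕ Fin n) :
    ∃ k, (concatGraph (tlGen i hi) a).Reachable x (Sum.inl k) := by
  obtain k | k := x
  · exact ⟨k, .refl _⟩
  have hne := pushAway_ne a.involutive_partner harch hthrough k
  exact ⟨_, (rel_pushAway (equivalence_concat_reachable_inr _ a) (concat_reachable_right hi a)
    (concat_reachable_partner a) k).trans (concat_reachable_through a hne.1 hne.2).symm⟩

theorem concatLoops_eq_zero (harch : a.partner (fstPoint hi) ≠ sndPoint hi)
    (hthrough : ¬ (a.partner (fstPoint hi) = fstPoint hi ∧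
      a.partner (sndPoint hi) = sndPoint hi)) : concatLoops (tlGen i hi) a = 0 := by
  rw [concatLoops, Nat.card_eq_zero]
  refine Or.inl ⟨fun ⟨C, hC⟩ ↦ ?_⟩
  induction C using SimpleGraph.ConnectedComponent.ind with | _ x =>
  obtain ⟨k, hk⟩ := exists_concat_reachable_inl harch hthrough x
  exact (hC k).1 (SimpleGraph.ConnectedComponent.sound hk.symm)

theorem eq_or_eq_of_concat_reachable (harch : a.partner (fstPoint hi) = sndPoint hi)
    (hx : (concatGraph (tlGen i hi) a).Reachable x (Sum.inr (fstPoint hi))) :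
    x = Sum.inr (fstPoint hi) ∨ x = Sum.inr (sndPoint hi) := by
  have := a.partner_partner
  have hS : Equivalence fun x y : Fin n ⊕ Fin n ↦
      ((x = Sum.inr (fstPoint hi) ∨ x = Sum.inr (sndPoint hi)) ↔
        (y = Sum.inr (fstPoint hi) ∨ y = Sum.inr (sndPoint hi))) := ⟨fun _ ↦ .rfl, .symm, .trans⟩
  exact (rel_of_concat_reachable hS (by simp) (by simp) (by simp +contextual) (by grind) hx).2
    (Or.inl rfl)

theorem concatLoops_of_arch (harch : a.partner (fstPoint hi) = sndPoint hi) :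
    concatLoops (tlGen i hi) a = 1 := by
  rw [concatLoops, Nat.card_eq_one_iff_exists]
  refine ⟨⟨(concatGraph (tlGen i hi) a).connectedComponentMk (Sum.inr (fstPoint hi)),
    fun k ↦ ⟨fun hk ↦ ?_, fun hk hk' ↦ ?_⟩⟩, fun ⟨C, hC⟩ ↦ ?_⟩
  · simpa using eq_or_eq_of_concat_reachable harch (SimpleGraph.ConnectedComponent.exact hk)
  · have := eq_or_eq_of_concat_reachable harch (SimpleGraph.ConnectedComponent.exact hk')
    have := a.partner_partner (fstPoint hi)
    have := fstPoint_ne_sndPoint hi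
    grind
  · ext1
    induction C using SimpleGraph.ConnectedComponent.ind with | _ x =>
    refine SimpleGraph.ConnectedComponent.sound ?_
    obtain k | k := x
    · exact absurd rfl (hC k).1
    by_cases hk : k = fstPoint hi
    · rw [hk]
    by_cases hk' : k = sndPoint hi
    · rw [hk']
      exact (concat_reachable_right hi a).symm
    · exact absurd (SimpleGraph.ConnectedComponent.sound (concat_reachable_through a hk hk'))
        (hC k).1

end concat

/-- The scalar by which `e_{i+1}` maps the basis element of `a` to a multiple of the one of
`a.cap hi`. -/
noncomputable def capCoeff {n i : ℕ} (q : ℝ) (a : HalfDiagram n) (hi : i + 1 < n) : ℝ :=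
  if a.partner (fstPoint hi) = sndPoint hi then q
  else if a.partner (fstPoint hi) = fstPoint hi ∧ a.partner (sndPoint hi) = sndPoint hi then 0
  else 1

theorem tlAct_single {n i : ℕ} (q : ℝ) (a : HalfDiagram n) (hi : i + 1 < n) :
    tlAct q (tlGen i hi) (Finsupp.single a 1) =
      (capCoeff q a hi : ℂ) • Finsupp.single (a.cap hi) 1 := by
  rw [tlAct, Finsupp.linearCombination_single, one_smul, tlActBasis, capCoeff]
  by_cases hthrough : a.partner (fstPoint hi) = fstPoint hi ∧ a.partner (sndPoint hi) = sndPoint hi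
  · have harch : a.partner (fstPoint hi) ≠ sndPoint hi :=
      hthrough.1.trans_ne (fstPoint_ne_sndPoint hi)
    rw [dif_neg fun h ↦ h.1 (concatVanishes_iff.2 hthrough), if_neg harch, if_pos hthrough,
      Complex.ofReal_zero, zero_smul]
  · have hex : ¬ ConcatVanishes (tlGen i hi) a ∧ ∃ b, IsConcat (tlGen i hi) a b :=
      ⟨mt concatVanishes_iff.1 hthrough, _, isConcat_cap⟩
    rw [dif_pos hex, hex.2.choose_spec.unique isConcat_cap, Finsupp.smul_single, smul_eq_mul,
      mul_one, if_neg hthrough]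
    split_ifs with harch
    · rw [concatLoops_of_arch harch, pow_one]
    · rw [concatLoops_eq_zero harch hthrough, pow_zero, Complex.ofReal_one]

section relations

open HalfDiagram

variable {n i j : ℕ} {hi : i + 1 < n} {hj : j + 1 < n} {a : HalfDiagram n} {q : ℝ}

theorem capCoeff_of_arch (h : a.partner (fstPoint hi) = sndPoint hi) : capCoeff q a hi = q :=
  if_pos h

theorem capCoeff_of_through (hu : a.partner (fstPoint hi) = fstPoint hi)
    (hv : a.partner (sndPoint hi) = sndPoint hi) : capCoeff q a hi = 0 := by
  rw [capCoeff, if_neg (hu.trans_ne (fstPoint_ne_sndPoint hi)), if_pos ⟨hu, hv⟩]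

theorem capCoeff_eq_one (harch : a.partner (fstPoint hi) ≠ sndPoint hi)
    (hthrough : ¬ (a.partner (fstPoint hi) = fstPoint hi ∧
      a.partner (sndPoint hi) = sndPoint hi)) : capCoeff q a hi = 1 := by
  rw [capCoeff, if_neg harch, if_neg hthrough]

theorem capCoeff_mul_capCoeff_cap_comm (hij : i + 1 < j ∨ j + 1 < i) :
    capCoeff q a hi * capCoeff q (a.cap hi) hj = capCoeff q a hj * capCoeff q (a.cap hj) hi := by
  have := fstPoint_ne_of_far (hi := hi) (hj := hj) hij
  have := fstPoint_ne_sndPoint hi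
  have := fstPoint_ne_sndPoint hj
  have := a.partner_partner
  have := congrFun (partner_cap a hi)
  have := congrFun (partner_cap a hj)
  by_cases hi₁ : a.partner (fstPoint hi) = sndPoint hi
  · rw [cap_eq_self hi₁, capCoeff_of_arch hi₁,
      capCoeff_of_arch (a := a.cap hj) (by grind [joinPair]), mul_comm]
  by_cases hj₁ : a.partner (fstPoint hj) = sndPoint hj
  · rw [cap_eq_self hj₁, capCoeff_of_arch hj₁,
      capCoeff_of_arch (a := a.cap hi) (by grind [joinPair]), mul_comm]
  by_cases hi₂ : a.partner (fstPoint hi) = fstPoint hi ∧ a.partner (sndPoint hi) = sndPoint hi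
  · rw [capCoeff_of_through hi₂.1 hi₂.2, capCoeff_of_through (a := a.cap hj) (by grind [joinPair])
      (by grind [joinPair]), zero_mul, mul_zero]
  by_cases hj₂ : a.partner (fstPoint hj) = fstPoint hj ∧ a.partner (sndPoint hj) = sndPoint hj
  · rw [capCoeff_of_through hj₂.1 hj₂.2, capCoeff_of_through (a := a.cap hi) (by grind [joinPair])
      (by grind [joinPair]), zero_mul, mul_zero]
  have harch : (a.cap hi).partner (fstPoint hj) = sndPoint hj ↔
      (a.cap hj).partner (fstPoint hi) = sndPoint hi := by
    grind [joinPair]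
  have hthrough : ((a.cap hi).partner (fstPoint hj) = fstPoint hj ∧
      (a.cap hi).partner (sndPoint hj) = sndPoint hj) ↔
      ((a.cap hj).partner (fstPoint hi) = fstPoint hi ∧
        (a.cap hj).partner (sndPoint hi) = sndPoint hi) := by
    grind (splits := 30) [joinPair]
  have hcap : capCoeff q (a.cap hi) hj = capCoeff q (a.cap hj) hi := by
    rw [capCoeff, capCoeff, if_congr harch rfl (if_congr hthrough rfl rfl)]
  rw [capCoeff_eq_one hi₁ hi₂, capCoeff_eq_one hj₁ hj₂, hcap]

theorem cap_cap_comm (hij : i + 1 < j ∨ j + 1 < i) : (a.cap hi).cap hj = (a.cap hj).cap hi := by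
  obtain ⟨h₁, h₂, h₃, h₄⟩ := fstPoint_ne_of_far (hi := hi) (hj := hj) hij
  exact HalfDiagram.ext (joinPair_joinPair_comm a.involutive_partner (fstPoint_ne_sndPoint hj)
    (fstPoint_ne_sndPoint hi) h₁.symm h₃.symm h₂.symm h₄.symm)

theorem tlAct_single_of_arch (h : a.partner (fstPoint hi) = sndPoint hi) :
    tlAct q (tlGen i hi) (Finsupp.single a 1) = (q : ℂ) • Finsupp.single a 1 := by
  rw [tlAct_single, capCoeff_of_arch h, cap_eq_self h]

theorem tlAct_single_of_through (hu : a.partner (fstPoint hi) = fstPoint hi)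
    (hv : a.partner (sndPoint hi) = sndPoint hi) :
    tlAct q (tlGen i hi) (Finsupp.single a 1) = 0 := by
  rw [tlAct_single, capCoeff_of_through hu hv, Complex.ofReal_zero, zero_smul]

theorem tlAct_comp_self (q : ℝ) (hi : i + 1 < n) :
    tlAct q (tlGen i hi) ∘ₗ tlAct q (tlGen i hi) = (q : ℂ) • tlAct q (tlGen i hi) := by
  refine Finsupp.basisSingleOne.ext fun a ↦ ?_
  simp only [Finsupp.coe_basisSingleOne, LinearMap.comp_apply, LinearMap.smul_apply]
  rw [tlAct_single, map_smul, tlAct_single_of_arch (a.partner_cap_fstPoint hi), smul_comm]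

theorem tlAct_comp_comm (q : ℝ) (hi : i + 1 < n) (hj : j + 1 < n)
    (hij : i + 1 < j ∨ j + 1 < i) :
    tlAct q (tlGen i hi) ∘ₗ tlAct q (tlGen j hj) =
      tlAct q (tlGen j hj) ∘ₗ tlAct q (tlGen i hi) := by
  refine Finsupp.basisSingleOne.ext fun a ↦ ?_
  simp only [Finsupp.coe_basisSingleOne, LinearMap.comp_apply, tlAct_single, map_smul, smul_smul]
  rw [cap_cap_comm hij, ← Complex.ofReal_mul, ← Complex.ofReal_mul,
    capCoeff_mul_capCoeff_cap_comm hij]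

theorem fstPoint_eq_or_of_adjacent (hij : j = i + 1 ∨ i = j + 1) :
    (fstPoint hj = sndPoint hi ∧ sndPoint hj ≠ fstPoint hi ∧ sndPoint hj ≠ sndPoint hi) ∨
      (sndPoint hj = fstPoint hi ∧ fstPoint hj ≠ fstPoint hi ∧ fstPoint hj ≠ sndPoint hi) := by
  simp only [ne_eq, Fin.ext_iff, val_fstPoint, val_sndPoint]
  omega

theorem tlAct_tlAct_single_of_arch (hij : j = i + 1 ∨ i = j + 1)
    (h : a.partner (fstPoint hi) = sndPoint hi) :
    tlAct q (tlGen i hi) (tlAct q (tlGen j hj) (Finsupp.single a 1)) = Finsupp.single a 1 := by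
  have := fstPoint_ne_sndPoint hi
  have := fstPoint_ne_sndPoint hj
  have := a.partner_partner
  have := fstPoint_eq_or_of_adjacent (hi := hi) (hj := hj) hij
  have := congrFun (partner_cap a hj)
  have hcap : (a.cap hj).cap hi = a := by
    refine HalfDiagram.ext (funext fun k ↦ ?_)
    have := congrFun (partner_cap (a.cap hj) hi) k
    grind [joinPair]
  have hfst : capCoeff q a hj = 1 := capCoeff_eq_one (by grind) (by grind)
  have hsnd : capCoeff q (a.cap hj) hi = 1 :=
    capCoeff_eq_one (by grind [joinPair]) (by grind [joinPair])
  rw [tlAct_single, map_smul, tlAct_single, hcap, hfst, hsnd, Complex.ofReal_one, one_smul,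
    one_smul]

theorem tlAct_comp_comp_self (q : ℝ) (hi : i + 1 < n) (hj : j + 1 < n)
    (hij : j = i + 1 ∨ i = j + 1) :
    tlAct q (tlGen i hi) ∘ₗ tlAct q (tlGen j hj) ∘ₗ tlAct q (tlGen i hi) =
      tlAct q (tlGen i hi) := by
  refine Finsupp.basisSingleOne.ext fun a ↦ ?_
  simp only [Finsupp.coe_basisSingleOne, LinearMap.comp_apply]
  rw [tlAct_single, map_smul, map_smul,
    tlAct_tlAct_single_of_arch hij (a.partner_cap_fstPoint hi)]

end relations

section glue

open Function HalfDiagram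

variable {n i : ℕ} {hi : i + 1 < n} {a b : HalfDiagram n} {q : ℝ} {s t : Fin n}

theorem glueGraph_comm (a b : HalfDiagram n) : glueGraph a b = glueGraph b a := by
  simp only [glueGraph, or_comm]

theorem glueVanishes_comm : GlueVanishes a b ↔ GlueVanishes b a := by
  simp only [GlueVanishes, glueGraph_comm a b, or_comm]

theorem glueLoops_comm (a b : HalfDiagram n) : glueLoops a b = glueLoops b a := by
  unfold glueLoops
  rw [glueGraph_comm a b]
  simp only [and_comm]

theorem halfFormBasis_comm (q : ℝ) (a b : HalfDiagram n) :
    halfFormBasis q a b = halfFormBasis q b a := by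
  by_cases h : GlueVanishes a b
  · rw [halfFormBasis, halfFormBasis, if_pos h, if_pos (glueVanishes_comm.1 h)]
  · rw [halfFormBasis, halfFormBasis, if_neg h, if_neg (mt glueVanishes_comm.2 h), glueLoops_comm]

theorem glue_reachable_left (a b : HalfDiagram n) (k : Fin n) :
    (glueGraph a b).Reachable k (a.partner k) := reachable_fromRel (Or.inl rfl)

theorem glue_reachable_right (a b : HalfDiagram n) (k : Fin n) :
    (glueGraph a b).Reachable k (b.partner k) := reachable_fromRel (Or.inr rfl)

theorem rel_of_glue_reachable {S : Fin n → Fin n → Prop} (hS : Equivalence S)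
    (ha : ∀ k, S k (a.partner k)) (hb : ∀ k, S k (b.partner k))
    (h : (glueGraph a b).Reachable s t) : S s t := by
  refine rel_of_reachable_fromRel hS ?_ h
  rintro s t (rfl | rfl)
  · exact ha s
  · exact hb s

theorem glue_reachable_of_arch (ha : a.partner (fstPoint hi) = sndPoint hi) (b : HalfDiagram n) :
    (glueGraph a b).Reachable (fstPoint hi) (sndPoint hi) :=
  ha ▸ glue_reachable_left a b (fstPoint hi)

/-- The map on points that carries the paths of a gluing with `b` to paths of the gluing with
`b.cap hi` which avoid the arch created by the cap. -/
def HalfDiagram.capMap (b : HalfDiagram n) (hi : i + 1 < n) : Fin n → Fin n :=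
  pushAway (fstPoint hi) (sndPoint hi) b.partner

theorem glue_reachable_capMap (ha : a.partner (fstPoint hi) = sndPoint hi) (k : Fin n) :
    (glueGraph a b).Reachable k (b.capMap hi k) :=
  rel_pushAway (SimpleGraph.reachable_is_equivalence _) (glue_reachable_of_arch ha b)
    (glue_reachable_right a b) k

theorem glue_reachable_of_cap (ha : a.partner (fstPoint hi) = sndPoint hi)
    (h : (glueGraph a (b.cap hi)).Reachable s t) : (glueGraph a b).Reachable s t := by
  refine rel_of_glue_reachable (SimpleGraph.reachable_is_equivalence _) (glue_reachable_left a b)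
    (fun k ↦ ?_) h
  rw [partner_cap]
  exact rel_joinPair (SimpleGraph.reachable_is_equivalence _) (glue_reachable_of_arch ha b)
    (glue_reachable_right a b) k

theorem partner_eq_or_eq_iff (ha : a.partner (fstPoint hi) = sndPoint hi) (k : Fin n) :
    (k = fstPoint hi ∨ k = sndPoint hi) ↔
      (a.partner k = fstPoint hi ∨ a.partner k = sndPoint hi) := by
  have := a.partner_partner
  grind

theorem eq_or_eq_iff_of_glue_cap_reachable (ha : a.partner (fstPoint hi) = sndPoint hi)
    (h : (glueGraph a (b.cap hi)).Reachable s t) :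
    (s = fstPoint hi ∨ s = sndPoint hi) ↔ (t = fstPoint hi ∨ t = sndPoint hi) :=
  rel_of_glue_reachable (S := fun s t ↦ (s = fstPoint hi ∨ s = sndPoint hi) ↔
      (t = fstPoint hi ∨ t = sndPoint hi))
    ⟨fun _ ↦ Iff.rfl, Iff.symm, Iff.trans⟩ (partner_eq_or_eq_iff ha)
    (partner_eq_or_eq_iff (partner_cap_fstPoint b hi)) h

theorem capMap_partner_of_arch (ha : a.partner (fstPoint hi) = sndPoint hi) (k : Fin n) :
    b.capMap hi (a.partner k) = b.capMap hi k ∨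
      b.capMap hi k = k ∧ b.capMap hi (a.partner k) = a.partner k := by
  have hk := partner_eq_or_eq_iff ha k
  by_cases h : k = fstPoint hi ∨ k = sndPoint hi
  · exact Or.inl ((if_pos (hk.1 h)).trans (if_pos h).symm)
  · exact Or.inr ⟨if_neg h, if_neg (mt hk.2 h)⟩

theorem glue_cap_reachable_capMap (ha : a.partner (fstPoint hi) = sndPoint hi)
    (h : (glueGraph a b).Reachable s t) :
    (glueGraph a (b.cap hi)).Reachable (b.capMap hi s) (b.capMap hi t) := by
  set H := glueGraph a (b.cap hi)
  have hH : Equivalence H.Reachable := SimpleGraph.reachable_is_equivalence _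
  refine rel_of_glue_reachable (S := fun s t ↦ H.Reachable (b.capMap hi s) (b.capMap hi t))
    (hH.comap _) (fun k ↦ ?_) (fun k ↦ ?_) h
  · obtain hk | ⟨hk, hk'⟩ := capMap_partner_of_arch (b := b) ha k
    · rw [hk]
    · rw [hk, hk']
      exact glue_reachable_left a (b.cap hi) k
  · refine rel_pushAway_apply b.involutive_partner hH (fun l ↦ ?_) k
    rw [← partner_cap]
    exact glue_reachable_right a (b.cap hi) l

theorem capMap_of_partner_eq (ha : a.partner (fstPoint hi) = sndPoint hi)
    (hs : a.partner s = s) : b.capMap hi s = s := by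
  have := a.partner_partner s
  have := fstPoint_ne_sndPoint hi
  have := a.partner_partner (fstPoint hi)
  exact pushAway_of_ne (by grind) (by grind)

theorem bijOn_capMap (hthrough : ¬ (b.partner (fstPoint hi) = fstPoint hi ∧
    b.partner (sndPoint hi) = sndPoint hi)) :
    Set.BijOn (b.capMap hi) (fixedPoints b.partner) (fixedPoints (b.cap hi).partner) := by
  rw [partner_cap]
  exact bijOn_pushAway b.involutive_partner (fstPoint_ne_sndPoint hi) hthrough

theorem glueVanishes_cap_iff (ha : a.partner (fstPoint hi) = sndPoint hi)
    (hthrough : ¬ (b.partner (fstPoint hi) = fstPoint hi ∧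
      b.partner (sndPoint hi) = sndPoint hi)) :
    GlueVanishes a (b.cap hi) ↔ GlueVanishes a b := by
  have hbij := bijOn_capMap hthrough
  constructor
  · rintro ⟨s, t, hst, hr, ⟨hs, ht⟩ | ⟨hs, ht⟩⟩
    · exact ⟨s, t, hst, glue_reachable_of_cap ha hr, Or.inl ⟨hs, ht⟩⟩
    · obtain ⟨s, hs', rfl⟩ := hbij.surjOn hs
      obtain ⟨t, ht', rfl⟩ := hbij.surjOn ht
      exact ⟨s, t, fun h ↦ hst (congrArg _ h), (glue_reachable_capMap ha s).trans
        ((glue_reachable_of_cap ha hr).trans (glue_reachable_capMap ha t).symm), Or.inr ⟨hs', ht'⟩⟩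
  · rintro ⟨s, t, hst, hr, ⟨hs, ht⟩ | ⟨hs, ht⟩⟩
    · have hr' := glue_cap_reachable_capMap ha hr
      rw [capMap_of_partner_eq ha hs, capMap_of_partner_eq ha ht] at hr'
      exact ⟨s, t, hst, hr', Or.inl ⟨hs, ht⟩⟩
    · exact ⟨_, _, fun h ↦ hst (hbij.injOn hs ht h), glue_cap_reachable_capMap ha hr,
        Or.inr ⟨hbij.mapsTo hs, hbij.mapsTo ht⟩⟩

/-- The closed loops of a gluing, the components which `glueLoops` counts. -/
def loopComponents (a b : HalfDiagram n) : Set (glueGraph a b).ConnectedComponent :=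
  {C | ∀ k ∈ C.supp, a.partner k ≠ k ∧ b.partner k ≠ k}

theorem glueLoops_eq_ncard (a b : HalfDiagram n) : glueLoops a b = (loopComponents a b).ncard := rfl

theorem connectedComponentMk_mem_loopComponents :
    (glueGraph a b).connectedComponentMk s ∈ loopComponents a b ↔
      ∀ k, (glueGraph a b).Reachable k s → a.partner k ≠ k ∧ b.partner k ≠ k := by
  simp only [loopComponents, Set.mem_ofPred_eq, SimpleGraph.ConnectedComponent.mem_supp_iff,
    SimpleGraph.ConnectedComponent.eq]

theorem connectedComponentMk_capMap_mem_loopComponents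
    (ha : a.partner (fstPoint hi) = sndPoint hi)
    (hthrough : ¬ (b.partner (fstPoint hi) = fstPoint hi ∧
      b.partner (sndPoint hi) = sndPoint hi)) :
    (glueGraph a (b.cap hi)).connectedComponentMk (b.capMap hi s) ∈ loopComponents a (b.cap hi) ↔
      (glueGraph a b).connectedComponentMk s ∈ loopComponents a b := by
  have hbij := bijOn_capMap hthrough
  simp only [connectedComponentMk_mem_loopComponents]
  have hdown {k} (hk : (glueGraph a (b.cap hi)).Reachable k (b.capMap hi s)) :
      (glueGraph a b).Reachable k s :=
    (glue_reachable_of_cap ha hk).trans (glue_reachable_capMap ha s).symm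
  refine ⟨fun h k hk ↦ ⟨fun hak ↦ ?_, fun hbk ↦ ?_⟩, fun h k hk ↦ ⟨fun hak ↦ ?_, fun hck ↦ ?_⟩⟩
  · have hk' := glue_cap_reachable_capMap ha hk
    rw [capMap_of_partner_eq ha hak] at hk'
    exact (h k hk').1 hak
  · exact (h _ (glue_cap_reachable_capMap ha hk)).2 (hbij.mapsTo hbk)
  · exact (h k (hdown hk)).1 hak
  · obtain ⟨l, hl, rfl⟩ := hbij.surjOn hck
    exact (h l ((glue_reachable_capMap ha l).trans (hdown hk))).2 hl

theorem connectedComponentMk_fstPoint_mem_loopComponents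
    (ha : a.partner (fstPoint hi) = sndPoint hi) (b : HalfDiagram n) :
    (glueGraph a (b.cap hi)).connectedComponentMk (fstPoint hi) ∈ loopComponents a (b.cap hi) := by
  refine connectedComponentMk_mem_loopComponents.2 fun k hk ↦ ?_
  have hne := fstPoint_ne_sndPoint hi
  have ha' := ha ▸ a.partner_partner (fstPoint hi)
  obtain rfl | rfl := (eq_or_eq_iff_of_glue_cap_reachable ha hk).2 (Or.inl rfl)
  · exact ⟨ha ▸ hne.symm, partner_cap_fstPoint b hi ▸ hne.symm⟩
  · exact ⟨ha'.trans_ne hne, (partner_cap_sndPoint b hi).trans_ne hne⟩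

theorem glueLoops_cap (ha : a.partner (fstPoint hi) = sndPoint hi)
    (harch : b.partner (fstPoint hi) ≠ sndPoint hi)
    (hthrough : ¬ (b.partner (fstPoint hi) = fstPoint hi ∧
      b.partner (sndPoint hi) = sndPoint hi)) :
    glueLoops a (b.cap hi) = glueLoops a b + 1 := by
  set H := glueGraph a (b.cap hi)
  let φ : (glueGraph a b).ConnectedComponent → H.ConnectedComponent :=
    SimpleGraph.ConnectedComponent.lift (fun k ↦ H.connectedComponentMk (b.capMap hi k))
      fun _ _ p _ ↦ SimpleGraph.ConnectedComponent.sound (glue_cap_reachable_capMap ha p.reachable)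
  have hφ : Injective φ := by
    refine SimpleGraph.ConnectedComponent.ind₂ fun s t hst ↦ ?_
    exact SimpleGraph.ConnectedComponent.sound ((glue_reachable_capMap ha s).trans
      ((glue_reachable_of_cap ha (SimpleGraph.ConnectedComponent.exact hst)).trans
        (glue_reachable_capMap ha t).symm))
  have hnotMem : H.connectedComponentMk (fstPoint hi) ∉ φ '' loopComponents a b := by
    rintro ⟨C, -, hC⟩
    induction C using SimpleGraph.ConnectedComponent.ind with | _ s =>
    obtain ⟨hu, hv⟩ := pushAway_ne b.involutive_partner harch hthrough s
    exact ((eq_or_eq_iff_of_glue_cap_reachable ha (SimpleGraph.ConnectedComponent.exact hC)).2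
      (Or.inl rfl)).elim hu hv
  have hloops : loopComponents a (b.cap hi) =
      insert (H.connectedComponentMk (fstPoint hi)) (φ '' loopComponents a b) := by
    refine Set.Subset.antisymm (fun C hC ↦ ?_) ?_
    · induction C using SimpleGraph.ConnectedComponent.ind with | _ s =>
      by_cases hs' : s = fstPoint hi ∨ s = sndPoint hi
      · refine Or.inl (SimpleGraph.ConnectedComponent.sound ?_)
        exact hs'.elim (fun h ↦ h ▸ .rfl) fun h ↦ h ▸ (glue_reachable_of_arch ha _).symm
      · have hmap : b.capMap hi s = s := if_neg hs'
        refine Or.inr ⟨(glueGraph a b).connectedComponentMk s, ?_, congrArg _ hmap⟩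
        rwa [← connectedComponentMk_capMap_mem_loopComponents ha hthrough, hmap]
    · refine Set.insert_subset (connectedComponentMk_fstPoint_mem_loopComponents ha b) ?_
      refine Set.image_subset_iff.2 fun C hC ↦ ?_
      induction C using SimpleGraph.ConnectedComponent.ind with | _ s =>
      exact (connectedComponentMk_capMap_mem_loopComponents ha hthrough).2 hC
  rw [glueLoops_eq_ncard, glueLoops_eq_ncard, hloops, Set.ncard_insert_of_notMem hnotMem,
    Set.ncard_image_of_injective _ hφ]

theorem capCoeff_mul_halfFormBasis_of_arch (q : ℝ) (ha : a.partner (fstPoint hi) = sndPoint hi)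
    (b : HalfDiagram n) :
    capCoeff q b hi * halfFormBasis q a (b.cap hi) = q * halfFormBasis q a b := by
  by_cases harch : b.partner (fstPoint hi) = sndPoint hi
  · rw [capCoeff_of_arch harch, cap_eq_self harch]
  by_cases hthrough : b.partner (fstPoint hi) = fstPoint hi ∧ b.partner (sndPoint hi) = sndPoint hi
  · have hvanish : GlueVanishes a b :=
      ⟨_, _, fstPoint_ne_sndPoint hi, glue_reachable_of_arch ha b, Or.inr hthrough⟩
    rw [capCoeff_of_through hthrough.1 hthrough.2, zero_mul, halfFormBasis, if_pos hvanish,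
      mul_zero]
  · have hiff := glueVanishes_cap_iff ha hthrough
    rw [capCoeff_eq_one harch hthrough, one_mul, halfFormBasis, halfFormBasis]
    by_cases hvanish : GlueVanishes a b
    · rw [if_pos hvanish, if_pos (hiff.2 hvanish), mul_zero]
    · rw [if_neg hvanish, if_neg (mt hiff.1 hvanish), glueLoops_cap ha harch hthrough, pow_succ']

theorem continuous_capCoeff (a : HalfDiagram n) (hi : i + 1 < n) :
    Continuous fun q ↦ capCoeff q a hi := by
  unfold capCoeff
  split_ifs <;> fun_prop

theorem continuous_halfFormBasis (a b : HalfDiagram n) :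
    Continuous fun q ↦ halfFormBasis q a b := by
  unfold halfFormBasis
  split_ifs <;> fun_prop

theorem capCoeff_mul_halfFormBasis_comm (q : ℝ) (a b : HalfDiagram n) (hi : i + 1 < n) :
    capCoeff q a hi * halfFormBasis q (a.cap hi) b =
      capCoeff q b hi * halfFormBasis q a (b.cap hi) := by
  -- Capping both diagrams gives `q` times either side, so the case `q = 0` needs a limit.
  refine congrFun (Continuous.ext_on (dense_compl_singleton (0 : ℝ))
    ((continuous_capCoeff a hi).mul (continuous_halfFormBasis _ b))
    ((continuous_capCoeff b hi).mul (continuous_halfFormBasis a _)) fun q hq ↦ ?_) q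
  have hleft := capCoeff_mul_halfFormBasis_of_arch q (partner_cap_fstPoint a hi) b
  have hright := capCoeff_mul_halfFormBasis_of_arch q (partner_cap_fstPoint b hi) a
  rw [halfFormBasis_comm, halfFormBasis_comm q _ a] at hright
  refine mul_left_cancel₀ hq ?_
  simp only [Pi.mul_apply]
  linear_combination capCoeff q b hi * hright - capCoeff q a hi * hleft

end glue

section form

variable {n i : ℕ}

theorem halfForm_add_left (q : ℝ) (u v w : HalfSpace n) :
    halfForm q (u + v) w = halfForm q u w + halfForm q v w := by
  unfold halfForm
  rw [Finsupp.sum_add_index'] <;> simp [Finsupp.sum, add_mul, Finset.sum_add_distrib]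

theorem halfForm_smul_left (q : ℝ) (c : ℂ) (v w : HalfSpace n) :
    halfForm q (c • v) w = c * halfForm q v w := by
  unfold halfForm
  rw [Finsupp.sum_smul_index' (by simp)]
  simp only [Finsupp.sum, Finset.mul_sum, smul_eq_mul, mul_assoc]

theorem conj_halfForm (q : ℝ) (v w : HalfSpace n) :
    starRingEnd ℂ (halfForm q v w) = halfForm q w v := by
  simp only [halfForm, Finsupp.sum, map_sum, map_mul, Complex.conj_ofReal, Complex.conj_conj]
  rw [Finset.sum_comm]
  refine Finset.sum_congr rfl fun a _ ↦ Finset.sum_congr rfl fun b _ ↦ ?_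
  rw [halfFormBasis_comm]
  ring

theorem halfForm_add_right (q : ℝ) (u v w : HalfSpace n) :
    halfForm q u (v + w) = halfForm q u v + halfForm q u w := by
  rw [← conj_halfForm, halfForm_add_left, map_add, conj_halfForm, conj_halfForm]

theorem halfForm_smul_right (q : ℝ) (c : ℂ) (v w : HalfSpace n) :
    halfForm q v (c • w) = starRingEnd ℂ c * halfForm q v w := by
  rw [← conj_halfForm, halfForm_smul_left, map_mul, conj_halfForm]

theorem halfForm_single (q : ℝ) (a b : HalfDiagram n) :
    halfForm q (Finsupp.single a 1) (Finsupp.single b 1) = halfFormBasis q a b := by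
  simp [halfForm]

theorem halfForm_tlAct (q : ℝ) (hi : i + 1 < n) (v w : HalfSpace n) :
    halfForm q (tlAct q (tlGen i hi) v) w = halfForm q v (tlAct q (tlGen i hi) w) := by
  induction v using Finsupp.induction_linear with
  | zero => simp [halfForm]
  | add v₁ v₂ h₁ h₂ => simp only [map_add, halfForm_add_left, h₁, h₂]
  | single a x =>
    induction w using Finsupp.induction_linear with
    | zero => simp [halfForm]
    | add w₁ w₂ h₁ h₂ => simp only [map_add, halfForm_add_right, h₁, h₂]
    | single b y =>
      rw [← Finsupp.smul_single_one a x, ← Finsupp.smul_single_one b y]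
      have hcap : (capCoeff q a hi : ℂ) * halfFormBasis q (a.cap hi) b =
          capCoeff q b hi * halfFormBasis q a (b.cap hi) := by
        exact_mod_cast capCoeff_mul_halfFormBasis_comm q a b hi
      simp only [map_smul, tlAct_single, halfForm_smul_left, halfForm_smul_right, halfForm_single,
        Complex.conj_ofReal]
      linear_combination x * starRingEnd ℂ y * hcap

end form

section whiteBox

open HalfDiagram

variable {n i j : ℕ} {hi : i + 1 < n} {hj : j + 1 < n} {a b c : HalfDiagram n} {q : ℝ}

theorem exists_isWhiteBox (q : ℝ) (a : HalfDiagram n) : ∃ v, IsWhiteBox q a v := by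
  induction a using box_induction with
  | minimal a ha => exact ⟨_, .minimal a ha⟩
  | box i hi a b hab ih =>
    obtain ⟨v, hv⟩ := ih a hab.closingSum_lt
    exact ⟨_, .box a b v i hi hv hab⟩

theorem tlAct_sub_smul_comm (q : ℝ) (hi : i + 1 < n) (hj : j + 1 < n)
    (hij : i + 1 < j ∨ j + 1 < i) (μ ν : ℂ) (x : HalfSpace n) :
    tlAct q (tlGen i hi) (tlAct q (tlGen j hj) x - ν • x) -
        μ • (tlAct q (tlGen j hj) x - ν • x) =
      tlAct q (tlGen j hj) (tlAct q (tlGen i hi) x - μ • x) -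
        ν • (tlAct q (tlGen i hi) x - μ • x) := by
  have hcomm := LinearMap.congr_fun (tlAct_comp_comm q hi hj hij) x
  simp only [LinearMap.comp_apply] at hcomm
  simp only [map_sub, map_smul, smul_sub, hcomm, smul_comm μ ν]
  abel

theorem IsWhiteBox.unique {v w : HalfSpace n} (hv : IsWhiteBox q a v) (hw : IsWhiteBox q a w) :
    v = w := by
  induction h : a.closingSum using Nat.strong_induction_on generalizing a v w with
  | _ m ih =>
    subst h
    cases hv with
    | minimal _ ha =>
      cases hw with
      | minimal _ _ => rfl
      | box c _ w j hj hw hc => exact absurd hc ha.not_isBoxAddition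
    | box b _ v i hi hv hb =>
      cases hw with
      | minimal _ ha => exact absurd hb ha.not_isBoxAddition
      | box c _ w j hj hw hc =>
        by_cases hij : i = j
        · subst hij
          obtain rfl := hb.unique_left hc
          rw [ih _ hb.closingSum_lt hv hw rfl]
        · obtain ⟨d, hdb, hdc⟩ := hb.diamond hc hij
          have hfar := hb.hasPeak.far_of_ne hc.hasPeak hij
          obtain ⟨u, hu⟩ := exists_isWhiteBox q d
          rw [ih _ hb.closingSum_lt hv (.box d b u j hj hu hdb) rfl,
            ih _ hc.closingSum_lt hw (.box d c u i hi hu hdc) rfl,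
            hdb.height_eq (by omega), hdc.height_eq (by omega)]
          exact tlAct_sub_smul_comm q hi hj hfar _ _ u

/-- The vector `ξ'_a`. -/
noncomputable def whiteBoxVector (q : ℝ) (a : HalfDiagram n) : HalfSpace n :=
  (exists_isWhiteBox q a).choose

theorem isWhiteBox_whiteBoxVector (q : ℝ) (a : HalfDiagram n) :
    IsWhiteBox q a (whiteBoxVector q a) := (exists_isWhiteBox q a).choose_spec

theorem HalfDiagram.IsMinimal.whiteBoxVector_eq (ha : a.IsMinimal) (q : ℝ) :
    whiteBoxVector q a = Finsupp.single a 1 :=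
  (isWhiteBox_whiteBoxVector q a).unique (.minimal a ha)

theorem HalfDiagram.IsBoxAddition.whiteBoxVector_eq (h : IsBoxAddition i hi a b) (q : ℝ) :
    whiteBoxVector q b = tlAct q (tlGen i hi) (whiteBoxVector q a) -
      (chebMu q (a.height (i + 1) + 1) : ℂ) • whiteBoxVector q a :=
  (isWhiteBox_whiteBoxVector q b).unique (.box a b _ i hi (isWhiteBox_whiteBoxVector q a) h)

theorem HalfDiagram.IsBoxAddition.tlAct_whiteBoxVector (h : IsBoxAddition i hi a b) (q : ℝ) :
    tlAct q (tlGen i hi) (whiteBoxVector q a) = whiteBoxVector q b +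
      (chebMu q (a.height (i + 1) + 1) : ℂ) • whiteBoxVector q a := by
  rw [h.whiteBoxVector_eq q, sub_add_cancel]

end whiteBox

section chebyshev

variable {q : ℝ} {k : ℤ}

theorem chebDelta_one (q : ℝ) : chebDelta q 1 = q := by
  simp [chebDelta]

theorem chebDelta_add_one (q : ℝ) (k : ℤ) :
    chebDelta q (k + 1) = q * chebDelta q k - chebDelta q (k - 1) := by
  rw [chebDelta, Polynomial.Chebyshev.S_add_one, Polynomial.eval_sub, Polynomial.eval_mul,
    Polynomial.eval_X]
  rfl

theorem chebMu_one (q : ℝ) : chebMu q 1 = q⁻¹ := by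
  simp [chebMu, chebDelta]

theorem chebMu_add_one_mul (hk : chebDelta q k ≠ 0) (hk' : chebDelta q (k + 1) ≠ 0) :
    chebMu q (k + 1) * (q - chebMu q k) = 1 := by
  rw [chebMu, chebMu, add_sub_cancel_right, div_mul_eq_mul_div, div_eq_one_iff_eq hk',
    chebDelta_add_one]
  field_simp

end chebyshev

section slope

open HalfDiagram

variable {n i j : ℕ} {hi : i + 1 < n} {hj : j + 1 < n} {a b c d : HalfDiagram n} {q : ℝ}

/-- The Dyck path of `a` has two steps in the same direction at the position `i + 1`. -/
def HalfDiagram.HasSlope (a : HalfDiagram n) (hi : i + 1 < n) : Prop :=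
  a.IsOpening (fstPoint hi) ↔ a.IsOpening (sndPoint hi)

theorem HalfDiagram.HasPeak.not_hasSlope (h : a.HasPeak hi) : ¬ a.HasSlope hi :=
  fun h' ↦ h.2 (h'.1 h.1)

theorem HalfDiagram.IsBoxAddition.hasPeak_of_hasSlope (h : IsBoxAddition j hj c a)
    (hij : j = i + 1 ∨ i = j + 1) (hslope : a.HasSlope hi) : c.HasPeak hi := by
  have hopening := h.opening
  have hclosing := h.closing
  have hmin := h.hasMinimum
  obtain rfl | rfl := hij
  · exact ⟨(h.other _ (by simp) (by simp; omega)).1 (hslope.2 hopening), hmin.1⟩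
  · exact ⟨hmin.2, fun h' ↦ hclosing (hslope.2 ((h.other _ (by simp; omega) (by simp)).2 h'))⟩

theorem HalfDiagram.IsBoxAddition.hasSlope_of_hasMinimum (h : IsBoxAddition i hi d c)
    (hij : j = i + 1 ∨ i = j + 1) (hmin : c.HasMinimum j hj) : d.HasSlope hj := by
  obtain rfl | rfl := hij
  · exact iff_of_true h.hasMinimum.2 ((h.other _ (by simp; omega) (by simp)).1 hmin.2)
  · exact iff_of_false (fun h' ↦ hmin.1 ((h.other _ (by simp) (by simp; omega)).2 h'))
      h.hasMinimum.1

theorem HalfDiagram.HasMinimum.height_add_one (h : a.HasMinimum i hi) :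
    a.height (i + 1) = a.height i - 1 :=
  height_succ_of_not_isOpening h.1

theorem HalfDiagram.HasPeak.height_eq_of_hasMinimum (h : c.HasPeak hi) (hmin : c.HasMinimum j hj)
    (hij : j = i + 1 ∨ i = j + 1) : c.height (j + 1) = c.height i := by
  obtain rfl | rfl := hij
  · have := height_succ_of_isOpening h.1
    have := hmin.height_add_one
    simp only [val_fstPoint] at *
    omega
  · rfl

theorem tlAct_tlAct_sub_of_eigenvector (hq : q ≠ 0) (hi : i + 1 < n) (hj : j + 1 < n)
    (hij : j = i + 1 ∨ i = j + 1) {x : HalfSpace n}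
    (hx : tlAct q (tlGen i hi) x = (q : ℂ) • x) :
    tlAct q (tlGen i hi) (tlAct q (tlGen j hj) x - (chebMu q 1 : ℂ) • x) = 0 := by
  have hq' : (q : ℂ) ≠ 0 := Complex.ofReal_ne_zero.2 hq
  have hbraid := LinearMap.congr_fun (tlAct_comp_comp_self q hi hj hij) x
  simp only [LinearMap.comp_apply] at hbraid
  rw [hx, map_smul, map_smul] at hbraid
  rw [map_sub, smul_right_injective _ hq' hbraid, map_smul, hx, smul_smul, chebMu_one,
    Complex.ofReal_inv, inv_mul_cancel₀ hq', one_smul, sub_self]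

theorem tlAct_tlAct_sub_tlAct_sub (hi : i + 1 < n) (hj : j + 1 < n)
    (hij : j = i + 1 ∨ i = j + 1) {x : HalfSpace n} (hx : tlAct q (tlGen j hj) x = 0) {μ μ' : ℝ}
    (hμ : μ' * (q - μ) = 1) :
    tlAct q (tlGen i hi) (tlAct q (tlGen j hj) (tlAct q (tlGen i hi) x - (μ : ℂ) • x) -
      (μ' : ℂ) • (tlAct q (tlGen i hi) x - (μ : ℂ) • x)) = 0 := by
  have hbraid := LinearMap.congr_fun (tlAct_comp_comp_self q hi hj hij) x
  have hsq := LinearMap.congr_fun (tlAct_comp_self q hi) x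
  simp only [LinearMap.comp_apply, LinearMap.smul_apply] at hbraid hsq
  have hμ' : (μ' : ℂ) * (q - μ) = 1 := by exact_mod_cast hμ
  simp only [map_sub, map_smul, hx, smul_zero, sub_zero, hbraid, hsq]
  rw [← sub_smul, smul_smul, hμ', one_smul, sub_self]

theorem tlAct_whiteBoxVector_of_hasPeak (q : ℝ) (a : HalfDiagram n) (hpeak : a.HasPeak hi)
    (hheight : a.height i = 0) :
    tlAct q (tlGen i hi) (whiteBoxVector q a) = (q : ℂ) • whiteBoxVector q a := by
  induction a using box_induction with
  | minimal a ha =>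
    rw [ha.whiteBoxVector_eq]
    exact tlAct_single_of_arch hpeak.partner_eq
  | box j hj c a hca ih =>
    have hij : i ≠ j := by
      rintro rfl
      have := c.height_nonneg (i + 1)
      have := hca.hasMinimum.height_add_one
      have := hca.height_eq (m := i) (by omega)
      omega
    have hfar := hpeak.far_of_ne hca.hasPeak hij
    have hc : c.HasPeak hi := by
      rwa [HasPeak, ← (hca.isOpening_iff_of_far hfar.symm).1,
        ← (hca.isOpening_iff_of_far hfar.symm).2]
    rw [hca.height_eq (by omega)] at hheight
    have hcomm := LinearMap.congr_fun (tlAct_comp_comm q hi hj hfar) (whiteBoxVector q c)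
    simp only [LinearMap.comp_apply] at hcomm
    rw [hca.whiteBoxVector_eq, map_sub, map_smul, hcomm, ih c hca.closingSum_lt hc hheight,
      map_smul, smul_sub, smul_comm (q : ℂ)]

theorem tlAct_whiteBoxVector_of_hasSlope (hi : i + 1 < n) (a : HalfDiagram n)
    (ha : MuDefined q n a.numPairs) (hslope : a.HasSlope hi) :
    tlAct q (tlGen i hi) (whiteBoxVector q a) = 0 := by
  induction a using box_induction generalizing i with
  | minimal a hmin =>
    rw [hmin.whiteBoxVector_eq]
    have hopening : a.IsOpening (fstPoint hi) := by
      by_contra h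
      exact h (hslope.2 (hmin.isOpening_sndPoint h))
    obtain ⟨hu, hv⟩ := hmin.partner_eq_self hopening (hslope.1 hopening)
    exact tlAct_single_of_through hu hv
  | box j hj c a hca ih =>
    have hc : MuDefined q n c.numPairs := hca.numPairs_eq ▸ ha
    have hμ := hc c j hj rfl hca.hasMinimum
    rw [hca.whiteBoxVector_eq]
    by_cases hfar : i + 1 < j ∨ j + 1 < i
    · have hcslope : c.HasSlope hi := by
        rwa [HasSlope, ← (hca.isOpening_iff_of_far hfar.symm).1,
          ← (hca.isOpening_iff_of_far hfar.symm).2]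
      have hcomm := LinearMap.congr_fun (tlAct_comp_comm q hi hj hfar) (whiteBoxVector q c)
      simp only [LinearMap.comp_apply] at hcomm
      rw [map_sub, map_smul, hcomm, ih c hca.closingSum_lt hi hc hcslope, map_zero, smul_zero,
        sub_zero]
    have hij : i ≠ j := by
      rintro rfl
      exact hca.hasPeak.not_hasSlope hslope
    replace hij : j = i + 1 ∨ i = j + 1 := by omega
    have hpeak := hca.hasPeak_of_hasSlope hij hslope
    rw [hpeak.height_eq_of_hasMinimum hca.hasMinimum hij] at hμ ⊢
    obtain hzero | hpos := (c.height_nonneg i).eq_or_lt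
    · rw [← hzero, zero_add] at hμ ⊢
      rw [chebDelta_one] at hμ
      exact tlAct_tlAct_sub_of_eigenvector hμ hi hj hij
        (tlAct_whiteBoxVector_of_hasPeak q c hpeak hzero.symm)
    · obtain ⟨d, hd⟩ := exists_isBoxAddition_of_height_pos hpeak hpos
      have hdμ : MuDefined q n d.numPairs := hd.numPairs_eq ▸ hc
      have hν := hdμ d i hi rfl hd.hasMinimum
      rw [hd.whiteBoxVector_eq]
      rw [hd.hasMinimum.height_add_one, sub_add_cancel, ← hd.height_eq (by omega)] at hν ⊢
      exact tlAct_tlAct_sub_tlAct_sub hi hj hij (ih d (hd.closingSum_lt.trans hca.closingSum_lt) hj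
        hdμ (hd.hasSlope_of_hasMinimum hij hca.hasMinimum)) (chebMu_add_one_mul hν hμ)

end slope

section orthogonality

open HalfDiagram

variable {n i : ℕ} {hi : i + 1 < n} {a b c m : HalfDiagram n} {q : ℝ} {v w : HalfSpace n}

theorem halfForm_zero_left (q : ℝ) (w : HalfSpace n) : halfForm q 0 w = 0 := by
  simpa only [zero_smul, zero_mul] using halfForm_smul_left q 0 0 w

theorem halfForm_sub_left (q : ℝ) (u v w : HalfSpace n) :
    halfForm q (u - v) w = halfForm q u w - halfForm q v w := by
  rw [eq_sub_iff_add_eq, ← halfForm_add_left, sub_add_cancel]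

theorem halfForm_eq_zero_comm : halfForm q v w = 0 ↔ halfForm q w v = 0 := by
  rw [← conj_halfForm, map_eq_zero]

theorem halfForm_eq_zero_of_eigenvector (hq : q ≠ 0)
    (hv : tlAct q (tlGen i hi) v = (q : ℂ) • v) (hw : tlAct q (tlGen i hi) w = 0) :
    halfForm q v w = 0 := by
  have h := halfForm_tlAct q hi v w
  rw [hv, hw, halfForm_smul_left, halfForm_eq_zero_comm.1 (halfForm_zero_left q v)] at h
  exact (mul_eq_zero.1 h).resolve_left (Complex.ofReal_ne_zero.2 hq)

theorem HalfDiagram.IsBoxAddition.halfForm_whiteBoxVector (h : IsBoxAddition i hi c b) (q : ℝ)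
    (w : HalfSpace n) :
    halfForm q (whiteBoxVector q b) w =
      halfForm q (whiteBoxVector q c) (tlAct q (tlGen i hi) w) -
        chebMu q (c.height (i + 1) + 1) * halfForm q (whiteBoxVector q c) w := by
  rw [h.whiteBoxVector_eq q, halfForm_sub_left, halfForm_smul_left, halfForm_tlAct]

theorem HalfDiagram.IsMinimal.exists_hasPeak (hm : m.IsMinimal) (ham : a ≠ m) :
    ∃ (i : ℕ) (hi : i + 1 < n), m.HasPeak hi ∧ a.HasSlope hi ∨ m.HasSlope hi ∧ a.HasPeak hi := by
  by_contra! hnone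
  refine ham (ext_of_isOpening fun k ↦ ?_)
  induction k using WellFoundedLT.induction with
  | _ k ih =>
    by_contra hk
    have hheight : a.height k = m.height k := height_congr ih
    have hpos : 0 < m.height k := by
      by_cases hopening : m.IsOpening k
      · exact hheight ▸ height_pos_of_not_isOpening fun h ↦ hk (iff_of_true h hopening)
      · exact height_pos_of_not_isOpening hopening
    obtain ⟨_ | i, hi⟩ := k
    · exact hpos.ne' m.height_zero
    have hopening : m.IsOpening (fstPoint hi) := by
      by_contra h
      have := hm _ h
      have := height_succ_of_not_isOpening h
      simp only [val_fstPoint] at *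
      omega
    have hopening' := (ih (fstPoint hi) (fstPoint_lt_sndPoint hi)).2 hopening
    have := hnone i hi
    simp only [HasPeak, HasSlope, sndPoint] at this
    tauto

theorem halfForm_whiteBoxVector_of_isMinimal (hq : q ≠ 0) (hm : m.IsMinimal)
    (hmμ : MuDefined q n m.numPairs) (ha : MuDefined q n a.numPairs) (ham : a ≠ m) :
    halfForm q (whiteBoxVector q a) (whiteBoxVector q m) = 0 := by
  induction h : a.closingSum using Nat.strong_induction_on generalizing a with
  | _ s ih =>
    subst h
    obtain ⟨i, hi, ⟨hpeak, hslope⟩ | ⟨hslope, hpeak⟩⟩ := hm.exists_hasPeak ham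
    · have heigen : tlAct q (tlGen i hi) (whiteBoxVector q m) = (q : ℂ) • whiteBoxVector q m := by
        rw [hm.whiteBoxVector_eq, tlAct_single_of_arch hpeak.partner_eq]
      exact halfForm_eq_zero_comm.1 (halfForm_eq_zero_of_eigenvector hq heigen
        (tlAct_whiteBoxVector_of_hasSlope hi a ha hslope))
    · have hzero := tlAct_whiteBoxVector_of_hasSlope hi m hmμ hslope
      obtain hheight | hheight := (a.height_nonneg i).eq_or_lt
      · exact halfForm_eq_zero_of_eigenvector hq
          (tlAct_whiteBoxVector_of_hasPeak q a hpeak hheight.symm) hzero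
      · obtain ⟨c, hc⟩ := exists_isBoxAddition_of_height_pos hpeak hheight
        have hcm : c ≠ m := by
          rintro rfl
          exact hc.hasMinimum.1 (hslope.2 hc.hasMinimum.2)
        rw [hc.halfForm_whiteBoxVector, hzero, halfForm_eq_zero_comm.1 (halfForm_zero_left q _),
          ih _ hc.closingSum_lt (hc.numPairs_eq ▸ ha) hcm rfl, mul_zero, sub_zero]

theorem halfForm_tlAct_whiteBoxVector_eq_zero (hi : i + 1 < n) (ha : MuDefined q n a.numPairs)
    (haw : halfForm q (whiteBoxVector q a) w = 0)
    (hbox : ∀ c, IsBoxAddition i hi c a ∨ IsBoxAddition i hi a c →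
      halfForm q (whiteBoxVector q c) w = 0) :
    halfForm q (tlAct q (tlGen i hi) (whiteBoxVector q a)) w = 0 := by
  by_cases hslope : a.HasSlope hi
  · rw [tlAct_whiteBoxVector_of_hasSlope hi a ha hslope, halfForm_zero_left]
  by_cases hmin : a.HasMinimum i hi
  · have hc := isBoxAddition_cap hmin
    rw [hc.tlAct_whiteBoxVector, halfForm_add_left, halfForm_smul_left, haw, hbox _ (.inr hc),
      mul_zero, add_zero]
  have hpeak : a.HasPeak hi := by
    rw [HasSlope] at hslope
    rw [hasMinimum_iff] at hmin
    rw [HasPeak]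
    tauto
  obtain hheight | hheight := (a.height_nonneg i).eq_or_lt
  · rw [tlAct_whiteBoxVector_of_hasPeak q a hpeak hheight.symm, halfForm_smul_left, haw, mul_zero]
  obtain ⟨c, hc⟩ := exists_isBoxAddition_of_height_pos hpeak hheight
  have hsq := LinearMap.congr_fun (tlAct_comp_self q hi) (whiteBoxVector q c)
  simp only [LinearMap.comp_apply, LinearMap.smul_apply] at hsq
  have hcw : halfForm q (tlAct q (tlGen i hi) (whiteBoxVector q c)) w = 0 := by
    rw [hc.tlAct_whiteBoxVector, halfForm_add_left, halfForm_smul_left, haw, hbox c (.inl hc),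
      mul_zero, add_zero]
  rw [hc.whiteBoxVector_eq, map_sub, map_smul, hsq, halfForm_sub_left, halfForm_smul_left,
    halfForm_smul_left, hcw, mul_zero, mul_zero, sub_zero]

theorem halfForm_whiteBoxVector_eq_zero (hq : q ≠ 0) (ha : MuDefined q n a.numPairs)
    (hb : MuDefined q n b.numPairs) (hab : a ≠ b) :
    halfForm q (whiteBoxVector q a) (whiteBoxVector q b) = 0 := by
  induction b using box_induction generalizing a with
  | minimal b hmin => exact halfForm_whiteBoxVector_of_isMinimal hq hmin hb ha hab
  | box i hi c b hcb ih =>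
    have hcμ : MuDefined q n c.numPairs := hcb.numPairs_eq ▸ hb
    have horth {d} (hd : MuDefined q n d.numPairs) (hdc : d ≠ c) :
        halfForm q (whiteBoxVector q d) (whiteBoxVector q c) = 0 :=
      ih c hcb.closingSum_lt hd hcμ hdc
    rw [halfForm_eq_zero_comm]
    by_cases hac : a = c
    · exact hac ▸ horth hb (hac ▸ hab.symm)
    rw [hcb.halfForm_whiteBoxVector,
      halfForm_eq_zero_comm.1 (horth ha hac), mul_zero, sub_zero, halfForm_eq_zero_comm]
    refine halfForm_tlAct_whiteBoxVector_eq_zero hi ha (horth ha hac) ?_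
    rintro d (hd | hd)
    · refine horth (hd.numPairs_eq ▸ ha) ?_
      rintro rfl
      exact hab (hd.unique_right hcb)
    · refine horth (hd.numPairs_eq.symm ▸ ha) ?_
      rintro rfl
      exact hcb.hasMinimum.1 hd.opening

end orthogonality

theorem mainTheorem1_general (n : ℕ) (q : ℝ) (hq : q ≠ 0) :
    (∀ a : HalfDiagram n, MuDefined q n a.numPairs → ∃! v : HalfSpace n, IsWhiteBox q a v) ∧
    (∀ (a b : HalfDiagram n) (v w : HalfSpace n),
      MuDefined q n a.numPairs → MuDefined q n b.numPairs →
      IsWhiteBox q a v → IsWhiteBox q b w → a ≠ b → halfForm q v w = 0) := by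
  refine ⟨fun a _ ↦ ⟨whiteBoxVector q a, isWhiteBox_whiteBoxVector q a, fun v hv ↦
    hv.unique (isWhiteBox_whiteBoxVector q a)⟩, fun a b v w ha hb hv hw hab ↦ ?_⟩
  rw [hv.unique (isWhiteBox_whiteBoxVector q a), hw.unique (isWhiteBox_whiteBoxVector q b)]
  exact halfForm_whiteBoxVector_eq_zero hq ha hb hab

theorem mainTheorem1 (n : ℕ) (q : ℝ) (hq : 0 < q) :
    (∀ a : HalfDiagram n, MuDefined q n a.numPairs → ∃! v : HalfSpace n, IsWhiteBox q a v) ∧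
    (∀ (a b : HalfDiagram n) (v w : HalfSpace n),
      MuDefined q n a.numPairs → MuDefined q n b.numPairs →
      IsWhiteBox q a v → IsWhiteBox q b w → a ≠ b → halfForm q v w = 0) :=
  mainTheorem1_general n q hq.ne'
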